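/- A \emph{concave distortion} is a concave increasing function $\Psi:[0,1]\to[0,1]$ with $\Psi(0)=0$, $\Psi(1)=1$. Let $(\Psi_t)_{t\ge0}$ be a concave distortion semigroup, i.e. a family of concave distortions with $\Psi_s\circ\Psi_t=\Psi_{s+t}$ for all $s,t\ge0$, and suppose that $\Psi_t$ is strictly concave on $[0,1]$ for every $t>0$. Let $(\Omega,\mathcal F,\mathsf P)$ be a probability space. For a random variable $X$ with distribution function $D_X$ put $$\int_{\mathbb R}x\,d(\Psi_t(D_X(x)))=\int x^+\,d(\Psi_t(D_X(x)))-\int x^-\,d(\Psi_t(D_X(x))),\qquad \infty-\infty=-\infty,$$ where the integrals are with respect to the Lebesgue--Stieltjes measure of the increasing function $x\mapsto\Psi_t(D_X(x))$, and where the limit of this function at $-\infty$, if positive, counts as mass at the point $-\infty$. Let $$\alpha(X)=\sup\Bigl\{t\ge0:\int_{\mathbb R}x\,d(\Psi_t(D_X(x)))\ge0\Bigr\}\in[0,\infty],\qquad \sup\emptyset=0,$$ and let $L^1(\alpha)$ be the set of random variables $X$ such that $\int_{\mathbb R}x\,d(\Psi_t(D_X(x)))>-\infty$ and $\int_{\mathbb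 R}x\,d(\Psi_t(D_{-X}(x)))>-\infty$ for all $t\ge0$. Let $d>1$, $S_0\in\mathbb R^d$, and let $S_1=(S_1^1,\dots,S_1^d)$ with all $S_1^i\in L^1(\alpha)$ have a joint density (with respect to Lebesgue measure on $\mathbb R^d$). Assume that $\mathsf E S_1\ne S_0$ and that there is no arbitrage, i.e. there is no $h\in\mathbb R^d$ with $\mathsf P(\langle h,S_1-S_0\rangle\ge0)=1$ and $\mathsf P(\langle h,S_1-S_0\rangle>0)>0$. Then the optimal value $$\sup_{h\in\mathbb R^d\setminus\{0\}}\alpha(\langle h,S_1-S_0\rangle)$$ is strictly positive and finite. It is attained at some $h_0\in\mathbb R^d\setminus\{0\}$, and the set of all maximizers is exactly $\{c\,h_0:c>0\}$. -/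

import Mathlib

open MeasureTheory ProbabilityTheory Set
open scoped NNReal ENNReal

noncomputable section

namespace DistortionSemigroup

/-- A concave distortion: a concave increasing function `Ψ : [0,1] → [0,1]` with `Ψ 0 = 0` and
`Ψ 1 = 1`. It is represented by a function on `ℝ` whose values outside `[0,1]` play no role. -/
structure ConcaveDistortion where
  /-- the underlying function -/
  toFun : ℝ → ℝ
  concaveOn : ConcaveOn ℝ (Icc 0 1) toFun
  monotoneOn : MonotoneOn toFun (Icc 0 1)
  map_zero : toFun 0 = 0
  map_one : toFun 1 = 1

instance : CoeFun ConcaveDistortion (fun _ => ℝ → ℝ) := ⟨ConcaveDistortion.toFun⟩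

/-- The semigroup property `Ψ_s ∘ Ψ_t = Ψ_{s+t}` on `[0,1]`, for all `s, t ≥ 0`. -/
def IsSemigroup (Ψ : ℝ≥0 → ConcaveDistortion) : Prop :=
  ∀ s t : ℝ≥0, ∀ x ∈ Icc (0 : ℝ) 1, Ψ s (Ψ t x) = Ψ (s + t) x

variable {Ω : Type*} [MeasurableSpace Ω]

/-- The function `x ↦ Ψ (D_X x)`, where `D_X` is the distribution function of `X` under `P`. -/
def distortedCDF (P : Measure Ω) (Ψ : ConcaveDistortion) (X : Ω → ℝ) (x : ℝ) : ℝ :=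
  Ψ (cdf (P.map X) x)

theorem distortedCDF_mono (P : Measure Ω) (Ψ : ConcaveDistortion) (X : Ω → ℝ) :
    Monotone (distortedCDF P Ψ X) := fun _ _ h =>
  Ψ.monotoneOn ⟨cdf_nonneg _ _, cdf_le_one _ _⟩ ⟨cdf_nonneg _ _, cdf_le_one _ _⟩
    (monotone_cdf _ h)

/-- The measure `d(Ψ(D_X(x)))` on the extended real line: the Lebesgue-Stieltjes measure of the
increasing function `x ↦ Ψ (D_X x)`, whose limit at `-∞`, which is positive exactly when
`Ψ(0+) > 0` and `X` is unbounded below, is the mass of the point `-∞`. -/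
def distortedLaw (P : Measure Ω) (Ψ : ConcaveDistortion) (X : Ω → ℝ) : Measure EReal :=
  ((distortedCDF_mono P Ψ X).stieltjesFunction.measure).map (fun x : ℝ => (x : EReal)) +
    ENNReal.ofReal (⨅ x : ℝ, distortedCDF P Ψ X x) • Measure.dirac ⊥

/-- The distorted expectation `∫ x d(Ψ(D_X(x))) = ∫ x⁺ d(Ψ(D_X(x))) - ∫ x⁻ d(Ψ(D_X(x)))`,
with the convention `∞ - ∞ = -∞` (which is that of subtraction on `EReal`). -/
def distortedExp (P : Measure Ω) (Ψ : ConcaveDistortion) (X : Ω → ℝ) : EReal :=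
  ((∫⁻ y, y.toENNReal ∂distortedLaw P Ψ X : ℝ≥0∞) : EReal) -
    ((∫⁻ y, (-y).toENNReal ∂distortedLaw P Ψ X : ℝ≥0∞) : EReal)

/-- The acceptability index `α(X) = sup {t ≥ 0 : ∫ x d(Ψ_t(D_X(x))) ≥ 0}`, with values in
`[0,∞]`; the supremum of the empty set is `0`. -/
def index (P : Measure Ω) (Ψ : ℝ≥0 → ConcaveDistortion) (X : Ω → ℝ) : ℝ≥0∞ :=
  ⨆ (t : ℝ≥0) (_ : 0 ≤ distortedExp P (Ψ t) X), (t : ℝ≥0∞)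

/-- The space `L¹(α)` of the random variables `X` such that the distorted expectations of `X` and
of `-X` are greater than `-∞` for every `t ≥ 0`. -/
def MemL1 (P : Measure Ω) (Ψ : ℝ≥0 → ConcaveDistortion) (X : Ω → ℝ) : Prop :=
  AEMeasurable X P ∧ ∀ t : ℝ≥0,
    ⊥ < distortedExp P (Ψ t) X ∧ ⊥ < distortedExp P (Ψ t) (fun ω => -X ω)

/-- The profit and loss `⟨h, S₁ - S₀⟩` of the portfolio `h`. -/
def pnl {d : ℕ} (S₀ : Fin d → ℝ) (S₁ : Ω → Fin d → ℝ) (h : Fin d → ℝ) (ω : Ω) : ℝ :=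
  ∑ i, h i * (S₁ ω i - S₀ i)

/-- There is no `h` with `P(⟨h, S₁ - S₀⟩ ≥ 0) = 1` and `P(⟨h, S₁ - S₀⟩ > 0) > 0`. -/
def NoArbitrage {d : ℕ} (P : Measure Ω) (S₀ : Fin d → ℝ) (S₁ : Ω → Fin d → ℝ) : Prop :=
  ¬ ∃ h : Fin d → ℝ, (∀ᵐ ω ∂P, 0 ≤ pnl S₀ S₁ h ω) ∧ 0 < P {ω | 0 < pnl S₀ S₁ h ω}

/-- The optimal value `sup {α(⟨h, S₁ - S₀⟩) : h ∈ ℝᵈ, h ≠ 0}`. -/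
def optimalValue {d : ℕ} (P : Measure Ω) (Ψ : ℝ≥0 → ConcaveDistortion)
    (S₀ : Fin d → ℝ) (S₁ : Ω → Fin d → ℝ) : ℝ≥0∞ :=
  ⨆ (h : Fin d → ℝ) (_ : h ≠ 0), index P Ψ (pnl S₀ S₁ h)

/-- `h` solves the problem `α(⟨h, S₁ - S₀⟩) → max`, `h ∈ ℝᵈ \ {0}`. -/
def IsOptimal {d : ℕ} (P : Measure Ω) (Ψ : ℝ≥0 → ConcaveDistortion)
    (S₀ : Fin d → ℝ) (S₁ : Ω → Fin d → ℝ) (h : Fin d → ℝ) : Prop :=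
  h ≠ 0 ∧ ∀ k : Fin d → ℝ, k ≠ 0 → index P Ψ (pnl S₀ S₁ k) ≤ index P Ψ (pnl S₀ S₁ h)

end DistortionSemigroup

end

/-! For an integrable enough `X`, the layer-cake formula turns the distorted expectation at time `t`
into the real number `u_t(X) = ∫ (1_{x>0} - Ψ_t(D_X(x))) dx`. On portfolios, `h ↦ u_t(⟨h, S₁ - S₀⟩)`
is positively homogeneous and superadditive, hence concave and continuous on `ℝᵈ`. It decreases in
`t` because `Ψ_r ≥ id`, and it is continuous in `t` by dominated convergence. The index is the last
time at which it is nonnegative, and the optimization is an argument about such families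
(`exists_unique_ray_levelIndex`).

Positivity: `u_0` is the mean, it is positive for `h = E S₁ - S₀`, and right-continuity keeps `u_t`
positive for small `t`. Finiteness: no arbitrage and the density give every nonzero portfolio a
genuine loss; since `Ψ_t → 1` on `(0,1]`, its `u_t` is eventually negative, and compactness of the
sphere makes the time uniform. Attainment: nested nonempty compact sets intersect. Uniqueness: two
maximizers on different rays have `u ≥ 0` at the optimal time, so strict superadditivity makes `u`
of their sum positive there, and right-continuity gives the sum a larger index.

The crux is strict superadditivity (`utility_superadditive`). Up to a jump at zero, `Ψ` is a mixture
of truncations `p ↦ min p c`, so `u` is a mixture of integrals of the quantile function over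
`(0,c)`, each superadditive by a variational formula. Equality for the mixture forces equality at
almost every level used. Strict concavity makes these levels dense, and equality at level `c` puts
`X` and `Y` on the same side of their `c`-quantiles. Hence `D_X(X) = D_Y(Y)` almost surely, which a
joint density rules out for portfolios on different rays. -/

open Filter Topology

noncomputable section

namespace DistortionSemigroup

/-! ### Elementary properties of concave distortions -/

namespace ConcaveDistortion

variable (Ψ : ConcaveDistortion) {p q : ℝ}

theorem self_le (hp : p ∈ Icc (0 : ℝ) 1) : p ≤ Ψ p := by
  have h := Ψ.concaveOn.2 (left_mem_Icc.2 zero_le_one) (right_mem_Icc.2 zero_le_one)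
    (sub_nonneg.2 hp.2) hp.1 (by ring)
  simpa [Ψ.map_zero, Ψ.map_one] using h

theorem le_one (hp : p ∈ Icc (0 : ℝ) 1) : Ψ p ≤ 1 :=
  Ψ.map_one ▸ Ψ.monotoneOn hp (right_mem_Icc.2 zero_le_one) hp.2

theorem mem_Icc (hp : p ∈ Icc (0 : ℝ) 1) : Ψ p ∈ Icc (0 : ℝ) 1 :=
  ⟨hp.1.trans (Ψ.self_le hp), Ψ.le_one hp⟩

theorem pos (hp : p ∈ Ioc (0 : ℝ) 1) : 0 < Ψ p := hp.1.trans_le (Ψ.self_le ⟨hp.1.le, hp.2⟩)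

/-- A concave distortion is subadditive. -/
theorem le_add (hp : p ∈ Icc (0 : ℝ) 1) (hq : q ∈ Icc (0 : ℝ) 1) (hpq : p + q ≤ 1) :
    Ψ (p + q) ≤ Ψ p + Ψ q := by
  rcases (add_nonneg hp.1 hq.1).eq_or_lt with h | h
  · have h1 : p = 0 := by linarith [hp.1, hq.1]
    have h2 : q = 0 := by linarith [hp.1, hq.1]
    simp [h1, h2, Ψ.map_zero]
  · have key : ∀ r ∈ Icc (0 : ℝ) (p + q), r / (p + q) * Ψ (p + q) ≤ Ψ r := by
      intro r hr
      have := Ψ.concaveOn.2 (left_mem_Icc.2 zero_le_one) (⟨h.le, hpq⟩ : p + q ∈ Icc (0 : ℝ) 1)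
        (sub_nonneg.2 ((div_le_one h).2 hr.2)) (div_nonneg hr.1 h.le) (by ring)
      simpa [Ψ.map_zero, div_mul_cancel₀ r h.ne'] using this
    have h1 := key p ⟨hp.1, by linarith [hq.1]⟩
    have h2 := key q ⟨hq.1, by linarith [hp.1]⟩
    calc Ψ (p + q) = p / (p + q) * Ψ (p + q) + q / (p + q) * Ψ (p + q) := by field_simp
      _ ≤ _ := add_le_add h1 h2

/-- Concavity gives continuity in the interior; at `1` the function is squeezed between the identity
and `1`. Zero is left out because a concave distortion may jump there. -/
theorem continuousOn_Ioc : ContinuousOn Ψ (Ioc 0 1) := by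
  intro p hp
  rcases hp.2.lt_or_eq with h1 | rfl
  · have := Ψ.concaveOn.continuousOn_interior
    rw [interior_Icc] at this
    exact (this.continuousAt (Ioo_mem_nhds hp.1 h1)).continuousWithinAt
  · have : Tendsto Ψ (𝓝[Ioc 0 1] 1) (𝓝 1) := by
      refine tendsto_of_tendsto_of_tendsto_of_le_of_le' (g := id) (h := fun _ => 1)
        (tendsto_id.mono_left nhdsWithin_le_nhds) tendsto_const_nhds ?_ ?_
      · filter_upwards [self_mem_nhdsWithin] with x hx using Ψ.self_le ⟨hx.1.le, hx.2⟩
      · filter_upwards [self_mem_nhdsWithin] with x hx using Ψ.le_one ⟨hx.1.le, hx.2⟩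
    rw [ContinuousWithinAt, Ψ.map_one]
    exact this

theorem tendsto_comp {u : ℕ → ℝ} (hp : p ∈ Ioc (0 : ℝ) 1) (hu : ∀ n, u n ∈ Ioc (0 : ℝ) 1)
    (h : Tendsto u atTop (𝓝 p)) : Tendsto (fun n => Ψ (u n)) atTop (𝓝 (Ψ p)) :=
  (Ψ.continuousOn_Ioc p hp).tendsto.comp
    (tendsto_nhdsWithin_iff.2 ⟨h, Eventually.of_forall hu⟩)

variable {Ψ}

theorem self_lt_of_strict (hs : StrictConcaveOn ℝ (Icc 0 1) Ψ) (hp : p ∈ Ioo (0 : ℝ) 1) :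
    p < Ψ p := by
  have h := hs.2 (left_mem_Icc.2 zero_le_one) (right_mem_Icc.2 zero_le_one) zero_ne_one
    (sub_pos.2 hp.2) hp.1 (by ring)
  simpa [Ψ.map_zero, Ψ.map_one] using h

theorem strictMonoOn_of_strict (hs : StrictConcaveOn ℝ (Icc 0 1) Ψ) :
    StrictMonoOn Ψ (Icc 0 1) := by
  intro p hp q hq hpq
  refine lt_of_le_of_ne (Ψ.monotoneOn hp hq hpq.le) fun he => ?_
  have hm : (1 / 2 : ℝ) • p + (1 / 2 : ℝ) • q ∈ Icc (0 : ℝ) 1 :=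
    Ψ.concaveOn.1 hp hq (by norm_num) (by norm_num) (by norm_num)
  have h1 := hs.2 hp hq hpq.ne (by norm_num : (0 : ℝ) < 1 / 2) (by norm_num : (0 : ℝ) < 1 / 2)
    (by norm_num)
  have h2 : Ψ ((1 / 2 : ℝ) • p + (1 / 2 : ℝ) • q) ≤ Ψ q :=
    Ψ.monotoneOn hm hq (by simp only [smul_eq_mul]; linarith)
  simp only [smul_eq_mul] at h1 h2
  linarith

theorem lt_one_of_strict (hs : StrictConcaveOn ℝ (Icc 0 1) Ψ) (hp : p ∈ Ico (0 : ℝ) 1) :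
    Ψ p < 1 :=
  Ψ.map_one ▸ strictMonoOn_of_strict hs ⟨hp.1, hp.2.le⟩ (right_mem_Icc.2 zero_le_one) hp.2

end ConcaveDistortion

/-! ### Continuity and limits of the semigroup in time -/

section Semigroup

variable {Ψ : ℝ≥0 → ConcaveDistortion} (hΨ : IsSemigroup Ψ)
  (hs : ∀ t : ℝ≥0, 0 < t → StrictConcaveOn ℝ (Icc 0 1) (Ψ t)) {p : ℝ}
include hΨ

theorem IsSemigroup.mono {s t : ℝ≥0} (hst : s ≤ t) (hp : p ∈ Icc (0 : ℝ) 1) :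
    Ψ s p ≤ Ψ t p := by
  obtain ⟨r, rfl⟩ := exists_add_of_le hst
  rw [add_comm, ← hΨ r s p hp]
  exact (Ψ r).self_le ((Ψ s).mem_Icc hp)

include hs

/-- Strict concavity makes `Ψ 1` injective, so it cancels from `Ψ 1 ∘ Ψ 0 = Ψ 1`. -/
theorem IsSemigroup.apply_zero (hp : p ∈ Icc (0 : ℝ) 1) : Ψ 0 p = p := by
  have h : Ψ 1 (Ψ 0 p) = Ψ 1 p := by rw [hΨ 1 0 p hp, add_zero]
  exact (ConcaveDistortion.strictMonoOn_of_strict (hs 1 one_pos)).injOn ((Ψ 0).mem_Icc hp) hp h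

/-- The semigroup is right-continuous at zero. -/
theorem IsSemigroup.tendsto_one_div (hp : p ∈ Icc (0 : ℝ) 1) :
    Tendsto (fun n : ℕ => Ψ (1 / ((n : ℝ≥0) + 1)) p) atTop (𝓝 p) := by
  set e : ℕ → ℝ≥0 := fun n => 1 / ((n : ℝ≥0) + 1) with he
  have he0 : ∀ n, 0 < e n := fun n => by positivity
  have hanti : Antitone e := fun m n h => by
    simp only [he]
    gcongr
  let φ : ℝ → ℝ := fun p => ⨅ n, Ψ (e n) p
  have hlim : ∀ p ∈ Icc (0 : ℝ) 1, Tendsto (fun n => Ψ (e n) p) atTop (𝓝 (φ p)) :=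
    fun p hp => tendsto_atTop_ciInf (fun m n h => hΨ.mono (hanti h) hp)
      ⟨0, by rintro _ ⟨n, rfl⟩; exact ((Ψ (e n)).mem_Icc hp).1⟩
  suffices h : φ p = p by
    have h' := hlim p hp
    rwa [h] at h'
  rcases hp.1.eq_or_lt with rfl | hp0
  · exact tendsto_nhds_unique (hlim 0 hp) (by simp [(Ψ _).map_zero])
  rcases hp.2.eq_or_lt with rfl | hp1
  · exact tendsto_nhds_unique (hlim 1 hp) (by simp [(Ψ _).map_one])
  have hple : p ≤ φ p := le_ciInf fun n => (Ψ (e n)).self_le hp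
  have hle : ∀ n, ∀ p ∈ Icc (0 : ℝ) 1, φ p ≤ Ψ (e n) p := fun n p hp =>
    ciInf_le ⟨0, by rintro _ ⟨n, rfl⟩; exact ((Ψ (e n)).mem_Icc hp).1⟩ n
  have hlt1 : φ p < 1 := (hle 0 p hp).trans_lt
    (ConcaveDistortion.lt_one_of_strict (hs _ (he0 0)) ⟨hp.1, hp1⟩)
  have hφmem : φ p ∈ Ioc (0 : ℝ) 1 := ⟨hp0.trans_le hple, hlt1.le⟩
  have hφmem' : φ p ∈ Icc (0 : ℝ) 1 := ⟨hφmem.1.le, hφmem.2⟩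
  -- The limit is idempotent: applying the distortion at time `1/(2n+2)` twice gives the one at time
  -- `1/(n+1)`, whence the index `2 * n + 1`.
  have hidem : φ (φ p) = φ p := by
    refine le_antisymm ?_ (le_ciInf fun n => (Ψ (e n)).self_le hφmem')
    refine ge_of_tendsto (hlim p hp) (Eventually.of_forall fun n => ?_)
    refine (hle (2 * n + 1) _ hφmem').trans ?_
    refine ((Ψ (e (2 * n + 1))).monotoneOn hφmem' ((Ψ _).mem_Icc hp) (hle (2 * n + 1) p hp)).trans
      (le_of_eq ?_)
    rw [hΨ _ _ p hp]
    congr 2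
    simp only [he]
    push_cast
    have : (n : ℝ≥0) + 1 ≠ 0 := by positivity
    field_simp
    ring
  by_contra hne
  have hlt : p < φ p := lt_of_le_of_ne hple (Ne.symm hne)
  -- If `p < φ p < 1`, write `φ p` as a convex combination of `p` and `1`. Concavity survives the
  -- limit and forces `φ (φ p) > φ p`, against idempotence.
  have hd : 0 < 1 - p := by linarith
  have hw1 : 0 ≤ (1 - φ p) / (1 - p) := div_nonneg (by linarith) hd.le
  have hw2 : 0 ≤ (φ p - p) / (1 - p) := div_nonneg (by linarith) hd.le
  have hw : (1 - φ p) / (1 - p) + (φ p - p) / (1 - p) = 1 := by field_simp; ring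
  have hcomb : (1 - φ p) / (1 - p) * p + (φ p - p) / (1 - p) = φ p := by field_simp; ring
  have hc : (1 - φ p) / (1 - p) * φ p + (φ p - p) / (1 - p) ≤ φ (φ p) := by
    refine ge_of_tendsto (hlim _ hφmem') (Eventually.of_forall fun n => ?_)
    have h := (Ψ (e n)).concaveOn.2 hp (right_mem_Icc.2 zero_le_one) hw1 hw2 hw
    simp only [smul_eq_mul, mul_one, (Ψ (e n)).map_one, hcomb] at h
    exact le_trans (by gcongr; exact hle n p hp) h
  rw [hidem] at hc
  have hpos : 0 < (1 - φ p) / (1 - p) := div_pos (by linarith) hd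
  nlinarith

theorem IsSemigroup.tendsto_add_one_div (t : ℝ≥0) (hp : p ∈ Icc (0 : ℝ) 1) :
    Tendsto (fun n : ℕ => Ψ (t + 1 / ((n : ℝ≥0) + 1)) p) atTop (𝓝 (Ψ t p)) := by
  rcases hp.1.eq_or_lt with rfl | hp0
  · simp [(Ψ _).map_zero]
  have := (Ψ t).tendsto_comp ⟨hp0, hp.2⟩
    (fun n : ℕ => (⟨(Ψ _).pos ⟨hp0, hp.2⟩, (Ψ _).le_one hp⟩ :
      Ψ (1 / ((n : ℝ≥0) + 1)) p ∈ Ioc (0 : ℝ) 1)) (hΨ.tendsto_one_div hs hp)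
  simpa only [hΨ t _ p hp] using this

theorem IsSemigroup.tendsto_sub_one_div (t : ℝ≥0) (ht : 0 < t) (hp : p ∈ Icc (0 : ℝ) 1) :
    Tendsto (fun n : ℕ => Ψ (t - 1 / ((n : ℝ≥0) + 1)) p) atTop (𝓝 (Ψ t p)) := by
  set e : ℕ → ℝ≥0 := fun n => 1 / ((n : ℝ≥0) + 1) with he
  have hanti : Antitone e := fun m n h => by
    simp only [he]
    gcongr
  have hbdd : BddAbove (range fun n => Ψ (t - e n) p) :=
    ⟨1, by rintro _ ⟨n, rfl⟩; exact (Ψ _).le_one hp⟩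
  have hlim : Tendsto (fun n => Ψ (t - e n) p) atTop (𝓝 (⨆ n, Ψ (t - e n) p)) :=
    tendsto_atTop_ciSup (fun m n h => hΨ.mono (tsub_le_tsub_left (hanti h) t) hp) hbdd
  set y := ⨆ n, Ψ (t - e n) p
  suffices h : y = Ψ t p by rwa [h] at hlim
  have hy1 : y ≤ Ψ t p := ciSup_le fun n => hΨ.mono tsub_le_self hp
  have hymem : y ∈ Icc (0 : ℝ) 1 :=
    ⟨((Ψ _).mem_Icc hp).1.trans (le_ciSup hbdd 0), hy1.trans ((Ψ t).le_one hp)⟩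
  -- Right-continuity at zero, applied at the monotone limit `y`, suffices: `Ψ t p` is the time-`e
  -- n` distortion of a value at most `y`.
  refine le_antisymm hy1 (ge_of_tendsto (hΨ.tendsto_one_div hs hymem) ?_)
  have hsmall : ∀ᶠ n in atTop, e n ≤ t := by
    obtain ⟨N, hN⟩ := exists_nat_one_div_lt (K := ℝ) (by exact_mod_cast ht : (0 : ℝ) < (t : ℝ))
    filter_upwards [eventually_ge_atTop N] with n hn
    refine (hanti hn).trans ?_
    rw [← NNReal.coe_le_coe]
    simpa [he] using hN.le
  filter_upwards [hsmall] with n hn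
  have h : Ψ t p = Ψ (e n) (Ψ (t - e n) p) := by rw [hΨ _ _ p hp, add_tsub_cancel_of_le hn]
  rw [h]
  exact (Ψ (e n)).monotoneOn ((Ψ _).mem_Icc hp) hymem (le_ciSup hbdd n)

/-- The increasing limit is a fixed point of `Ψ 1` in `(0,1]`, and strict concavity leaves only the
fixed point `1` there. -/
theorem IsSemigroup.tendsto_natCast (hp : p ∈ Ioc (0 : ℝ) 1) :
    Tendsto (fun n : ℕ => Ψ n p) atTop (𝓝 1) := by
  have hp' : p ∈ Icc (0 : ℝ) 1 := ⟨hp.1.le, hp.2⟩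
  have hbdd : BddAbove (range fun n : ℕ => Ψ n p) :=
    ⟨1, by rintro _ ⟨n, rfl⟩; exact (Ψ _).le_one hp'⟩
  have hlim : Tendsto (fun n : ℕ => Ψ n p) atTop (𝓝 (⨆ n : ℕ, Ψ n p)) :=
    tendsto_atTop_ciSup (fun m n h => hΨ.mono (by exact_mod_cast h) hp') hbdd
  set y := ⨆ n : ℕ, Ψ n p
  have hy : y ∈ Ioc (0 : ℝ) 1 :=
    ⟨((Ψ _).pos hp).trans_le (le_ciSup hbdd 0), ciSup_le fun n => (Ψ _).le_one hp'⟩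
  have h1 := (Ψ 1).tendsto_comp hy
    (fun n : ℕ => (⟨(Ψ _).pos hp, (Ψ _).le_one hp'⟩ : Ψ n p ∈ Ioc (0 : ℝ) 1)) hlim
  have h2 : Tendsto (fun n : ℕ => Ψ 1 (Ψ n p)) atTop (𝓝 y) := by
    refine ((tendsto_add_atTop_iff_nat 1).2 hlim).congr fun n => ?_
    rw [hΨ _ _ p hp', add_comm]
    push_cast
    rfl
  have h3 : Ψ 1 y = y := tendsto_nhds_unique h1 h2
  rcases hy.2.eq_or_lt with h | h
  · rwa [h] at hlim
  · exact absurd h3 (ConcaveDistortion.self_lt_of_strict (hs 1 one_pos) ⟨hy.1, h⟩).ne'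

end Semigroup

/-! ### Layer-cake form of the distorted expectation -/

section ExtendedExpectation

variable {Ω : Type*} [MeasurableSpace Ω] (P : Measure Ω) (Ψ : ConcaveDistortion) (X : Ω → ℝ)

theorem cdf_mem_Icc (μ : Measure ℝ) (x : ℝ) : cdf μ x ∈ Icc (0 : ℝ) 1 :=
  ⟨cdf_nonneg _ _, cdf_le_one _ _⟩

theorem distortedCDF_mem_Icc (x : ℝ) : distortedCDF P Ψ X x ∈ Icc (0 : ℝ) 1 :=
  Ψ.mem_Icc (cdf_mem_Icc _ x)

theorem tendsto_distortedCDF_atTop : Tendsto (distortedCDF P Ψ X) atTop (𝓝 1) :=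
  tendsto_of_tendsto_of_tendsto_of_le_of_le (tendsto_cdf_atTop (P.map X)) tendsto_const_nhds
    (fun x => Ψ.self_le (cdf_mem_Icc _ x)) (fun x => (distortedCDF_mem_Icc P Ψ X x).2)

theorem bddBelow_range_distortedCDF : BddBelow (range (distortedCDF P Ψ X)) :=
  ⟨0, by rintro _ ⟨x, rfl⟩; exact (distortedCDF_mem_Icc P Ψ X x).1⟩

/-- The Stieltjes function is the right limit of `distortedCDF`, which need not be right-continuous
since `Ψ` may jump at zero. Lebesgue integrals ignore the countable discrepancy. -/
theorem _root_.Monotone.rightLim_ae_eq {f : ℝ → ℝ} (hf : Monotone f) :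
    Function.rightLim f =ᵐ[volume] f := by
  have h : {x | ¬ContinuousAt f x}.Countable := hf.countable_not_continuousAt
  filter_upwards [h.ae_notMem volume] with x hx
  simp only [not_not] at hx
  exact hx.continuousWithinAt.rightLim_eq

theorem _root_.Monotone.tendsto_rightLim_atTop {f : ℝ → ℝ} (hf : Monotone f) {l : ℝ}
    (h : Tendsto f atTop (𝓝 l)) : Tendsto (Function.rightLim f) atTop (𝓝 l) :=
  tendsto_of_tendsto_of_tendsto_of_le_of_le h
    (h.comp (tendsto_atTop_add_const_right atTop (1 : ℝ) tendsto_id))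
    (fun _ => hf.le_rightLim le_rfl) (fun x => hf.rightLim_le (by simp))

theorem _root_.Monotone.tendsto_rightLim_atBot {f : ℝ → ℝ} (hf : Monotone f) {l : ℝ}
    (h : Tendsto f atBot (𝓝 l)) : Tendsto (Function.rightLim f) atBot (𝓝 l) :=
  tendsto_of_tendsto_of_tendsto_of_le_of_le h
    (h.comp (tendsto_atBot_add_const_right atBot (1 : ℝ) tendsto_id))
    (fun _ => hf.le_rightLim le_rfl) (fun x => hf.rightLim_le (by simp))

theorem lintegral_toENNReal_distortedLaw :
    ∫⁻ y, y.toENNReal ∂distortedLaw P Ψ X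
      = ∫⁻ x in Ioi (0 : ℝ), ENNReal.ofReal (1 - distortedCDF P Ψ X x) := by
  set f := distortedCDF P Ψ X
  have hf : Monotone f := distortedCDF_mono P Ψ X
  rw [distortedLaw, lintegral_add_measure, lintegral_smul_measure, lintegral_dirac,
    lintegral_map (by fun_prop) (by fun_prop)]
  simp only [EReal.toENNReal_bot, smul_zero, add_zero]
  have h1 : ∀ x : ℝ, (x : EReal).toENNReal = ENNReal.ofReal (max x 0) := fun x => by
    rw [EReal.toENNReal_of_ne_top (EReal.coe_ne_top x), EReal.toReal_coe]
    rcases le_total x 0 with h | h <;> simp [h, ENNReal.ofReal_of_nonpos]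
  simp only [h1]
  rw [lintegral_eq_lintegral_meas_lt _ (Eventually.of_forall fun x => le_max_right x 0)
    (by fun_prop)]
  refine lintegral_congr_ae ?_
  filter_upwards [ae_restrict_mem measurableSet_Ioi, ae_restrict_of_ae hf.rightLim_ae_eq]
    with t ht hft
  have hset : {a : ℝ | t < max a 0} = Ioi t := by
    ext a
    simp only [mem_ofPred_eq, lt_max_iff, mem_Ioi, or_iff_left_iff_imp]
    intro h
    exact absurd h (not_lt.2 (le_of_lt ht))
  rw [hset, StieltjesFunction.measure_Ioi _
    (hf.tendsto_rightLim_atTop (tendsto_distortedCDF_atTop P Ψ X)), hf.stieltjesFunction_eq, hft]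

/-- The Stieltjes measure of `(-∞, -t]` is `f (-t) - a`, with `a` the limit at `-∞`. The atom of
mass `a` at `⊥` contributes `a * ∞`, which is the integral of the missing constant `a` over `(0,
∞)`. -/
theorem lintegral_neg_toENNReal_distortedLaw :
    ∫⁻ y, (-y).toENNReal ∂distortedLaw P Ψ X
      = ∫⁻ x in Ioi (0 : ℝ), ENNReal.ofReal (distortedCDF P Ψ X (-x)) := by
  set f := distortedCDF P Ψ X with hfdef
  have hf : Monotone f := distortedCDF_mono P Ψ X
  set a : ℝ := ⨅ x : ℝ, f x
  have ha0 : 0 ≤ a := le_ciInf fun x => (distortedCDF_mem_Icc P Ψ X x).1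
  have haf : ∀ x, a ≤ f x := fun x => ciInf_le (bddBelow_range_distortedCDF P Ψ X) x
  have hbot : Tendsto f atBot (𝓝 a) :=
    tendsto_atBot_ciInf hf (bddBelow_range_distortedCDF P Ψ X)
  rw [distortedLaw, lintegral_add_measure, lintegral_smul_measure, lintegral_dirac,
    lintegral_map (by fun_prop) (by fun_prop)]
  simp only [EReal.neg_bot, EReal.toENNReal_top, smul_eq_mul]
  have h1 : ∀ x : ℝ, (-(x : EReal)).toENNReal = ENNReal.ofReal (max (-x) 0) := fun x => by
    rw [← EReal.coe_neg, EReal.toENNReal_of_ne_top (EReal.coe_ne_top _), EReal.toReal_coe]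
    rcases le_total x 0 with h | h <;> simp [h, ENNReal.ofReal_of_nonpos]
  simp only [h1]
  rw [lintegral_eq_lintegral_meas_le _ (Eventually.of_forall fun x => le_max_right (-x) 0)
    (by fun_prop)]
  have h2 : ∫⁻ t in Ioi (0 : ℝ), hf.stieltjesFunction.measure {x : ℝ | t ≤ max (-x) 0}
      = ∫⁻ t in Ioi (0 : ℝ), ENNReal.ofReal (f (-t) - a) := by
    refine lintegral_congr_ae ?_
    have hae : ∀ᵐ t : ℝ, Function.rightLim f (-t) = f (-t) :=
      (Measure.measurePreserving_neg (volume : Measure ℝ)).quasiMeasurePreserving.ae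
        hf.rightLim_ae_eq
    filter_upwards [ae_restrict_mem measurableSet_Ioi, ae_restrict_of_ae hae] with t ht hft
    have hset : {x : ℝ | t ≤ max (-x) 0} = Iic (-t) := by
      ext x
      simp only [mem_ofPred_eq, le_max_iff, mem_Iic]
      have : 0 < t := ht
      constructor
      · rintro (h | h) <;> linarith
      · intro h; left; linarith
    rw [hset, StieltjesFunction.measure_Iic _ (hf.tendsto_rightLim_atBot hbot),
      hf.stieltjesFunction_eq, hft]
  rw [h2]
  have h3 : ∫⁻ x in Ioi (0 : ℝ), ENNReal.ofReal (f (-x))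
      = (∫⁻ t in Ioi (0 : ℝ), ENNReal.ofReal (f (-t) - a))
        + ∫⁻ _ in Ioi (0 : ℝ), ENNReal.ofReal a := by
    rw [← lintegral_add_right _ measurable_const]
    refine lintegral_congr fun t => ?_
    rw [← ENNReal.ofReal_add (sub_nonneg.2 (haf _)) ha0, sub_add_cancel]
  rw [h3, lintegral_const, Measure.restrict_apply_univ, Real.volume_Ioi]

theorem distortedExp_eq : distortedExp P Ψ X
    = ((∫⁻ x in Ioi (0 : ℝ), ENNReal.ofReal (1 - distortedCDF P Ψ X x) : ℝ≥0∞) : EReal)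
      - ((∫⁻ x in Ioi (0 : ℝ), ENNReal.ofReal (distortedCDF P Ψ X (-x)) : ℝ≥0∞) : EReal) := by
  rw [distortedExp, lintegral_toENNReal_distortedLaw, lintegral_neg_toENNReal_distortedLaw]

end ExtendedExpectation

/-! ### Layer-cake formulas for the undistorted law -/

section Cdf

variable {Ω : Type*} [MeasurableSpace Ω] {P : Measure Ω} [IsProbabilityMeasure P] {X Y : Ω → ℝ}

theorem cdf_map_apply (hX : AEMeasurable X P) (x : ℝ) :
    cdf (P.map X) x = P.real {ω | X ω ≤ x} := by
  have := Measure.isProbabilityMeasure_map hX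
  rw [cdf_eq_real, map_measureReal_apply_of_aemeasurable hX measurableSet_Iic]
  rfl

theorem ofReal_cdf_map (hX : AEMeasurable X P) (x : ℝ) :
    ENNReal.ofReal (cdf (P.map X) x) = P {ω | X ω ≤ x} := by
  rw [cdf_map_apply hX, ofReal_measureReal]

theorem ofReal_one_sub_cdf_map (hX : AEMeasurable X P) (x : ℝ) :
    ENNReal.ofReal (1 - cdf (P.map X) x) = P {ω | x < X ω} := by
  have hset : {ω | x < X ω} = {ω | X ω ≤ x}ᶜ := by ext; simp
  have hn : NullMeasurableSet {ω | X ω ≤ x} P := hX.nullMeasurableSet_preimage measurableSet_Iic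
  rw [cdf_map_apply hX, hset, ← ofReal_measureReal, probReal_compl_eq_one_sub₀ hn]

theorem lintegral_cdf_sub (hX : AEMeasurable X P) (s : ℝ) :
    ∫⁻ t in Ioi (0 : ℝ), ENNReal.ofReal (cdf (P.map X) (s - t))
      = ∫⁻ ω, ENNReal.ofReal (s - X ω) ∂P := by
  have h1 : ∀ ω, ENNReal.ofReal (s - X ω) = ENNReal.ofReal (max (s - X ω) 0) := fun ω => by
    rcases le_total (s - X ω) 0 with h | h <;> simp [h, ENNReal.ofReal_of_nonpos]
  simp only [h1]
  rw [lintegral_eq_lintegral_meas_le _ (Eventually.of_forall fun x => le_max_right _ 0)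
    (by fun_prop)]
  refine setLIntegral_congr_fun measurableSet_Ioi fun t ht => ?_
  rw [ofReal_cdf_map hX]
  congr 1
  ext ω
  have : 0 < t := ht
  simp only [mem_ofPred_eq, le_max_iff]
  constructor
  · intro h; left; linarith
  · rintro (h | h) <;> linarith

theorem lintegral_one_sub_cdf (hX : AEMeasurable X P) :
    ∫⁻ t in Ioi (0 : ℝ), ENNReal.ofReal (1 - cdf (P.map X) t)
      = ∫⁻ ω, ENNReal.ofReal (X ω) ∂P := by
  have h1 : ∀ ω, ENNReal.ofReal (X ω) = ENNReal.ofReal (max (X ω) 0) := fun ω => by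
    rcases le_total (X ω) 0 with h | h <;> simp [h, ENNReal.ofReal_of_nonpos]
  simp only [h1]
  rw [lintegral_eq_lintegral_meas_lt _ (Eventually.of_forall fun x => le_max_right _ 0)
    (by fun_prop)]
  refine setLIntegral_congr_fun measurableSet_Ioi fun t ht => ?_
  rw [ofReal_one_sub_cdf_map hX]
  congr 1
  ext ω
  have : 0 < t := ht
  simp only [mem_ofPred_eq, lt_max_iff]
  constructor
  · intro h; left; linarith
  · rintro (h | h) <;> linarith

omit [IsProbabilityMeasure P] in
theorem integrable_of_lintegral_ofReal_ne_top (hX : AEMeasurable X P)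
    (h1 : ∫⁻ ω, ENNReal.ofReal (X ω) ∂P ≠ ⊤) (h2 : ∫⁻ ω, ENNReal.ofReal (-X ω) ∂P ≠ ⊤) :
    Integrable X P := by
  refine ⟨hX.aestronglyMeasurable, ?_⟩
  rw [hasFiniteIntegral_iff_norm]
  calc ∫⁻ ω, ENNReal.ofReal ‖X ω‖ ∂P
      ≤ ∫⁻ ω, (ENNReal.ofReal (X ω) + ENNReal.ofReal (-X ω)) ∂P := by
        refine lintegral_mono fun ω => ?_
        rcases le_total 0 (X ω) with h | h
        · simp [abs_of_nonneg h]
        · simp [abs_of_nonpos h]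
    _ = ∫⁻ ω, ENNReal.ofReal (X ω) ∂P + ∫⁻ ω, ENNReal.ofReal (-X ω) ∂P :=
        lintegral_add_left' (by fun_prop) _
    _ < ⊤ := ENNReal.add_lt_top.2 ⟨h1.lt_top, h2.lt_top⟩

end Cdf

/-! ### The distorted expectation as a real integral -/

section Utility

variable {Ω : Type*} [MeasurableSpace Ω] (P : Measure Ω) (Ψ : ConcaveDistortion) (X : Ω → ℝ)

/-- The integrand `1_{x > 0} - Ψ (D_X x)` of the layer-cake form of the distorted expectation. -/
def utilityDensity (x : ℝ) : ℝ := (Ioi (0 : ℝ)).indicator 1 x - distortedCDF P Ψ X x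

/-- The distorted expectation as a real number. -/
def utility : ℝ := ∫ x, utilityDensity P Ψ X x

/-- The random variables for which the distorted expectation is finite. -/
structure Admissible : Prop where
  integrable : Integrable X P
  integrableOn : IntegrableOn (fun x => distortedCDF P Ψ X (-x)) (Ioi 0)

/-- The identity distortion. -/
def idDistortion : ConcaveDistortion where
  toFun := id
  concaveOn := concaveOn_id (convex_Icc 0 1)
  monotoneOn := monotone_id.monotoneOn _
  map_zero := rfl
  map_one := rfl

theorem distortedCDF_id (x : ℝ) : distortedCDF P idDistortion X x = cdf (P.map X) x := rfl

variable {P Ψ X}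

@[fun_prop]
theorem measurable_distortedCDF : Measurable (distortedCDF P Ψ X) :=
  (distortedCDF_mono P Ψ X).measurable

theorem cdf_le_distortedCDF (x : ℝ) : cdf (P.map X) x ≤ distortedCDF P Ψ X x :=
  Ψ.self_le (cdf_mem_Icc _ x)

theorem integrableOn_iff_lintegral_ne_top {f : ℝ → ℝ} (hf : Measurable f) (h0 : ∀ x, 0 ≤ f x)
    (s : Set ℝ) : IntegrableOn f s ↔ ∫⁻ x in s, ENNReal.ofReal (f x) ≠ ⊤ :=
  (lintegral_ofReal_ne_top_iff_integrable hf.aestronglyMeasurable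
    (Eventually.of_forall h0)).symm

theorem integrableOn_Iic_of_comp_neg {f : ℝ → ℝ} (h : IntegrableOn (fun x => f (-x)) (Ioi 0)) :
    IntegrableOn f (Iic 0) := by
  rw [integrableOn_Iic_iff_integrableOn_Iio]
  have := (Measure.measurePreserving_neg (volume : Measure ℝ)).integrableOn_comp_preimage
    (MeasurableEquiv.neg ℝ).measurableEmbedding (f := f) (s := Iio 0)
  rw [← this]
  simpa [Function.comp_def] using h

theorem Admissible.integrableOn_Iic (h : Admissible P Ψ X) :
    IntegrableOn (distortedCDF P Ψ X) (Iic 0) := integrableOn_Iic_of_comp_neg h.integrableOn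

theorem utilityDensity_of_pos {x : ℝ} (hx : 0 < x) :
    utilityDensity P Ψ X x = 1 - distortedCDF P Ψ X x := by
  simp [utilityDensity, hx]

theorem utilityDensity_of_nonpos {x : ℝ} (hx : x ≤ 0) :
    utilityDensity P Ψ X x = -distortedCDF P Ψ X x := by
  simp [utilityDensity, hx]

variable [IsProbabilityMeasure P]

/-- With the convention `∞ - ∞ = -∞`, a value above `-∞` means that the negative part is finite. As
`D ≤ Ψ(D)`, this bounds the negative parts of both `X` and `-X`, so `X` is integrable. -/
theorem admissible_of_distortedExp (hX : AEMeasurable X P) (h1 : ⊥ < distortedExp P Ψ X)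
    (h2 : ⊥ < distortedExp P Ψ (fun ω => -X ω)) : Admissible P Ψ X := by
  have key : ∀ Y : Ω → ℝ, AEMeasurable Y P → ⊥ < distortedExp P Ψ Y →
      ∫⁻ x in Ioi (0 : ℝ), ENNReal.ofReal (distortedCDF P Ψ Y (-x)) ≠ ⊤ ∧
      ∫⁻ ω, ENNReal.ofReal (-Y ω) ∂P ≠ ⊤ := by
    intro Y hY h
    have hne : ∫⁻ x in Ioi (0 : ℝ), ENNReal.ofReal (distortedCDF P Ψ Y (-x)) ≠ ⊤ := by
      intro he
      rw [distortedExp_eq, he] at h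
      simp at h
    refine ⟨hne, ne_top_of_le_ne_top hne ?_⟩
    have := lintegral_cdf_sub hY 0
    simp only [zero_sub] at this
    rw [← this]
    exact lintegral_mono fun x => ENNReal.ofReal_le_ofReal (cdf_le_distortedCDF _)
  obtain ⟨k1, k2⟩ := key X hX h1
  obtain ⟨-, k4⟩ := key _ hX.neg h2
  simp only [Pi.neg_apply, neg_neg] at k4
  exact ⟨integrable_of_lintegral_ofReal_ne_top hX k4 k2,
    (integrableOn_iff_lintegral_ne_top (by fun_prop)
      (fun x => (distortedCDF_mem_Icc P Ψ X _).1) _).2 k1⟩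

/-- The upper tail needs no condition beyond integrability, since `1 - Ψ(D) ≤ 1 - D`. -/
theorem integrableOn_one_sub_distortedCDF (hX : Integrable X P) :
    IntegrableOn (fun x => 1 - distortedCDF P Ψ X x) (Ioi 0) := by
  rw [integrableOn_iff_lintegral_ne_top (by fun_prop)
      (fun x => sub_nonneg.2 (distortedCDF_mem_Icc P Ψ X _).2)]
  refine ne_top_of_le_ne_top hX.lintegral_lt_top.ne ?_
  rw [← lintegral_one_sub_cdf hX.aemeasurable]
  exact lintegral_mono fun x => ENNReal.ofReal_le_ofReal
    (sub_le_sub_left (cdf_le_distortedCDF _) _)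

theorem admissible_id (hX : Integrable X P) : Admissible P idDistortion X := by
  refine ⟨hX, (integrableOn_iff_lintegral_ne_top (by fun_prop)
      (fun x => (distortedCDF_mem_Icc P _ X _).1) _).2 ?_⟩
  have := lintegral_cdf_sub hX.aemeasurable 0
  simp only [zero_sub] at this
  simp only [distortedCDF_id, this]
  exact hX.neg.lintegral_lt_top.ne

theorem Admissible.integrableOn_Ioi_density (h : Admissible P Ψ X) :
    IntegrableOn (utilityDensity P Ψ X) (Ioi 0) :=
  (integrableOn_one_sub_distortedCDF h.integrable).congr_fun
    (fun _ hx => (utilityDensity_of_pos hx).symm) measurableSet_Ioi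

omit [IsProbabilityMeasure P] in
theorem Admissible.integrableOn_Iic_density (h : Admissible P Ψ X) :
    IntegrableOn (utilityDensity P Ψ X) (Iic 0) :=
  h.integrableOn_Iic.neg.congr_fun
    (fun _ hx => (utilityDensity_of_nonpos hx).symm) measurableSet_Iic

theorem Admissible.integrable_density (h : Admissible P Ψ X) :
    Integrable (utilityDensity P Ψ X) := by
  rw [← integrableOn_univ, ← Iic_union_Ioi (a := (0 : ℝ))]
  exact h.integrableOn_Iic_density.union h.integrableOn_Ioi_density

theorem Admissible.utility_eq (h : Admissible P Ψ X) :
    utility P Ψ X = (∫ x in Ioi (0 : ℝ), (1 - distortedCDF P Ψ X x))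
      - ∫ x in Ioi (0 : ℝ), distortedCDF P Ψ X (-x) := by
  rw [utility, ← intervalIntegral.integral_Iic_add_Ioi h.integrableOn_Iic_density
    h.integrableOn_Ioi_density, integral_comp_neg_Ioi, neg_zero,
    setIntegral_congr_fun measurableSet_Ioi (fun _ hx => utilityDensity_of_pos hx),
    setIntegral_congr_fun measurableSet_Iic (fun _ hx => utilityDensity_of_nonpos hx),
    integral_neg]
  ring

theorem Admissible.distortedExp_eq_utility (h : Admissible P Ψ X) :
    distortedExp P Ψ X = (utility P Ψ X : EReal) := by
  rw [distortedExp_eq, h.utility_eq, EReal.coe_sub,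
    ← ofReal_integral_eq_lintegral_ofReal (integrableOn_one_sub_distortedCDF h.integrable)
      (Eventually.of_forall fun x => sub_nonneg.2 (distortedCDF_mem_Icc P Ψ X _).2),
    ← ofReal_integral_eq_lintegral_ofReal h.integrableOn
      (Eventually.of_forall fun x => (distortedCDF_mem_Icc P Ψ X _).1),
    EReal.coe_ennreal_ofReal, EReal.coe_ennreal_ofReal, max_eq_left, max_eq_left]
  · exact integral_nonneg fun x => (distortedCDF_mem_Icc P Ψ X _).1
  · exact integral_nonneg fun x => sub_nonneg.2 (distortedCDF_mem_Icc P Ψ X _).2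

theorem utility_id (hX : Integrable X P) : utility P idDistortion X = ∫ ω, X ω ∂P := by
  rw [(admissible_id hX).utility_eq, integral_eq_lintegral_pos_part_sub_lintegral_neg_part hX,
    ← lintegral_one_sub_cdf hX.aemeasurable]
  have := lintegral_cdf_sub hX.aemeasurable 0
  simp only [zero_sub] at this
  rw [← this, integral_eq_lintegral_of_nonneg_ae
    (Eventually.of_forall fun x => sub_nonneg.2 (distortedCDF_mem_Icc P _ X _).2)
    (by fun_prop : Measurable _).aestronglyMeasurable, integral_eq_lintegral_of_nonneg_ae
    (Eventually.of_forall fun x => (distortedCDF_mem_Icc P _ X _).1)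
    (by fun_prop : Measurable _).aestronglyMeasurable]
  rfl

end Utility

/-! ### Stability under linear combinations -/

section Closure

variable {Ω : Type*} [MeasurableSpace Ω] {P : Measure Ω} [IsProbabilityMeasure P]
  {Ψ : ConcaveDistortion} {X Y : Ω → ℝ}

theorem cdf_add_le (hX : AEMeasurable X P) (hY : AEMeasurable Y P) (x y : ℝ) :
    cdf (P.map fun ω => X ω + Y ω) (x + y) ≤ cdf (P.map X) x + cdf (P.map Y) y := by
  rw [cdf_map_apply (hX.fun_add hY), cdf_map_apply hX, cdf_map_apply hY]
  refine (measureReal_mono fun ω hω => ?_).trans (measureReal_union_le _ _)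
  simp only [mem_ofPred_eq, mem_union] at hω ⊢
  by_contra! h
  linarith [h.1, h.2]

theorem distortedCDF_add_le (hX : AEMeasurable X P) (hY : AEMeasurable Y P) (x y : ℝ) :
    distortedCDF P Ψ (fun ω => X ω + Y ω) (x + y)
      ≤ distortedCDF P Ψ X x + distortedCDF P Ψ Y y := by
  rcases le_total (cdf (P.map X) x + cdf (P.map Y) y) 1 with h | h
  · exact (Ψ.monotoneOn (cdf_mem_Icc _ _)
      ⟨add_nonneg (cdf_nonneg _ _) (cdf_nonneg _ _), h⟩ (cdf_add_le hX hY x y)).trans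
      (Ψ.le_add (cdf_mem_Icc _ _) (cdf_mem_Icc _ _) h)
  · exact (distortedCDF_mem_Icc _ _ _ _).2.trans
      (h.trans (add_le_add (cdf_le_distortedCDF _) (cdf_le_distortedCDF _)))

theorem Admissible.add (hX : Admissible P Ψ X) (hY : Admissible P Ψ Y) :
    Admissible P Ψ (fun ω => X ω + Y ω) := by
  refine ⟨hX.integrable.add hY.integrable, ?_⟩
  -- Rescaling `x` to `2 * x` splits the threshold `-2x` into `-x` for each summand.
  have h := integrableOn_Ioi_comp_mul_left_iff
    (fun x => distortedCDF P Ψ (fun ω => X ω + Y ω) (-x)) 0 (two_pos (α := ℝ))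
  rw [mul_zero] at h
  rw [← h]
  refine (hX.integrableOn.add hY.integrableOn).mono'
    (by fun_prop : Measurable _).aestronglyMeasurable (Eventually.of_forall fun x => ?_)
  rw [Real.norm_of_nonneg (distortedCDF_mem_Icc _ _ _ _).1, show -(2 * x) = -x + -x by ring]
  exact distortedCDF_add_le hX.integrable.aemeasurable hY.integrable.aemeasurable _ _

theorem distortedCDF_const_mul {c : ℝ} (hc : 0 < c) (hX : AEMeasurable X P) (x : ℝ) :
    distortedCDF P Ψ (fun ω => c * X ω) x = distortedCDF P Ψ X (x / c) := by
  rw [distortedCDF, distortedCDF, cdf_map_apply (hX.const_mul c), cdf_map_apply hX]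
  congr 3
  ext ω
  simp only [le_div_iff₀ hc, mul_comm]

theorem Admissible.const_mul {c : ℝ} (hc : 0 < c) (hX : Admissible P Ψ X) :
    Admissible P Ψ (fun ω => c * X ω) := by
  refine ⟨hX.integrable.const_mul c, ?_⟩
  have h := integrableOn_Ioi_comp_mul_left_iff
    (fun x => distortedCDF P Ψ (fun ω => c * X ω) (-x)) 0 hc
  rw [mul_zero] at h
  rw [← h]
  convert hX.integrableOn using 2 with x
  rw [distortedCDF_const_mul hc hX.integrable.aemeasurable]
  congr 1
  field_simp

theorem utility_const_mul {c : ℝ} (hc : 0 < c) (hX : AEMeasurable X P) :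
    utility P Ψ (fun ω => c * X ω) = c * utility P Ψ X := by
  have h : ∀ x, utilityDensity P Ψ (fun ω => c * X ω) x = utilityDensity P Ψ X (x / c) := by
    intro x
    rw [utilityDensity, utilityDensity, distortedCDF_const_mul hc hX]
    congr 1
    by_cases hx : 0 < x
    · rw [indicator_of_mem (mem_Ioi.2 hx), indicator_of_mem (mem_Ioi.2 (div_pos hx hc))]; rfl
    · rw [indicator_of_notMem (by simpa using hx),
        indicator_of_notMem (by simpa using div_nonpos_of_nonpos_of_nonneg (not_lt.1 hx) hc.le)]
  simp only [utility, h]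
  rw [Measure.integral_comp_div, abs_of_pos hc, smul_eq_mul]

theorem admissible_const (k : ℝ) : Admissible P Ψ (fun _ => k) := by
  refine ⟨integrable_const k, ?_⟩
  have hint : IntegrableOn ((Iic |k|).indicator (1 : ℝ → ℝ)) (Ioi 0) := by
    rw [integrableOn_indicator_iff measurableSet_Iic]
    exact integrableOn_const (by rw [Iic_inter_Ioi]; simp)
  refine hint.mono' (by fun_prop : Measurable _).aestronglyMeasurable
    (Eventually.of_forall fun x => ?_)
  rw [Real.norm_of_nonneg (distortedCDF_mem_Icc _ _ _ _).1]
  by_cases hx : x ≤ |k|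
  · simpa [hx] using (distortedCDF_mem_Icc _ _ _ _).2
  · rw [indicator_of_notMem (by simpa using hx), distortedCDF, cdf_map_apply aemeasurable_const]
    have : {ω : Ω | k ≤ -x} = ∅ := by
      ext ω
      simp only [mem_ofPred_eq, mem_empty_iff_false, iff_false, not_le]
      linarith [neg_abs_le k]
    simp [this, Ψ.map_zero]

theorem Admissible.mul_of_neg (hX : Admissible P Ψ X) (hX' : Admissible P Ψ fun ω => -X ω)
    (c : ℝ) : Admissible P Ψ (fun ω => c * X ω) := by
  rcases lt_trichotomy c 0 with h | rfl | h
  · convert hX'.const_mul (neg_pos.2 h) using 2 with ω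
    ring
  · simpa using admissible_const 0
  · exact hX.const_mul h

theorem Admissible.sum {ι : Type*} (s : Finset ι) {Z : ι → Ω → ℝ}
    (h : ∀ i, Admissible P Ψ (Z i)) : Admissible P Ψ (fun ω => ∑ i ∈ s, Z i ω) := by
  classical
  induction s using Finset.induction_on with
  | empty => simpa using admissible_const 0
  | insert i s hi ih =>
    simp only [Finset.sum_insert hi]
    exact (h i).add ih

theorem admissible_pnl {d : ℕ} {S₀ : Fin d → ℝ} {S₁ : Ω → Fin d → ℝ}
    (h1 : ∀ i, Admissible P Ψ fun ω => S₁ ω i) (h2 : ∀ i, Admissible P Ψ fun ω => -S₁ ω i)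
    (h : Fin d → ℝ) : Admissible P Ψ (pnl S₀ S₁ h) := by
  refine Admissible.sum (Z := fun i ω => h i * (S₁ ω i - S₀ i)) Finset.univ fun i => ?_
  convert ((h1 i).mul_of_neg (h2 i) (h i)).add (admissible_const (-(h i * S₀ i))) using 2 with ω
  ring

end Closure

/-! ### Dependence of the utility on time -/

section Time

variable {Ω : Type*} [MeasurableSpace Ω] {P : Measure Ω} {Ψ : ℝ≥0 → ConcaveDistortion}
  (hΨ : IsSemigroup Ψ) {X : Ω → ℝ}
include hΨ

theorem IsSemigroup.utilityDensity_anti {s t : ℝ≥0} (hst : s ≤ t) (x : ℝ) :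
    utilityDensity P (Ψ t) X x ≤ utilityDensity P (Ψ s) X x :=
  sub_le_sub_left (hΨ.mono hst (cdf_mem_Icc _ _)) _

variable [IsProbabilityMeasure P]

theorem IsSemigroup.utility_anti (hX : ∀ t, Admissible P (Ψ t) X) :
    Antitone fun t => utility P (Ψ t) X := fun _ _ hst =>
  integral_mono (hX _).integrable_density (hX _).integrable_density
    (hΨ.utilityDensity_anti hst)

/-- Monotonicity in time sandwiches every integrand between those at times `0` and `T`, which
supplies the dominating function. -/
theorem IsSemigroup.tendsto_utility (hX : ∀ t, Admissible P (Ψ t) X) {u : ℕ → ℝ≥0}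
    {T t : ℝ≥0} (hu : ∀ n, u n ≤ T)
    (h : ∀ p ∈ Icc (0 : ℝ) 1, Tendsto (fun n => Ψ (u n) p) atTop (𝓝 (Ψ t p))) :
    Tendsto (fun n => utility P (Ψ (u n)) X) atTop (𝓝 (utility P (Ψ t) X)) := by
  refine tendsto_integral_of_dominated_convergence
    (fun x => |utilityDensity P (Ψ 0) X x| + |utilityDensity P (Ψ T) X x|)
    (fun n => (hX _).integrable_density.aestronglyMeasurable)
    ((hX 0).integrable_density.abs.add (hX T).integrable_density.abs)
    (fun n => Eventually.of_forall fun x => ?_) (Eventually.of_forall fun x => ?_)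
  · have h1 := hΨ.utilityDensity_anti (P := P) (X := X) (zero_le (a := u n)) x
    have h2 := hΨ.utilityDensity_anti (P := P) (X := X) (hu n) x
    rw [Real.norm_eq_abs, abs_le]
    constructor
    · linarith [neg_abs_le (utilityDensity P (Ψ T) X x), abs_nonneg (utilityDensity P (Ψ 0) X x)]
    · linarith [le_abs_self (utilityDensity P (Ψ 0) X x), abs_nonneg (utilityDensity P (Ψ T) X x)]
  · exact tendsto_const_nhds.sub (h _ (cdf_mem_Icc _ _))

/-- The gain part tends to zero because `Ψ n → 1` at positive arguments, while the loss part stays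
at least `ε * D_X(-ε)`, which is positive for some `ε`. -/
theorem IsSemigroup.exists_utility_neg
    (hs : ∀ t : ℝ≥0, 0 < t → StrictConcaveOn ℝ (Icc 0 1) (Ψ t))
    (hX : ∀ t, Admissible P (Ψ t) X) (hneg : P {ω | X ω < 0} ≠ 0) :
    ∃ t, utility P (Ψ t) X < 0 := by
  have hXm : AEMeasurable X P := (hX 0).integrable.aemeasurable
  obtain ⟨ε, hε, hF⟩ : ∃ ε > 0, 0 < cdf (P.map X) (-ε) := by
    by_contra! hc
    apply hneg
    have hU : {ω | X ω < 0} ⊆ ⋃ n : ℕ, {ω | X ω ≤ -(1 / ((n : ℝ) + 1))} := by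
      intro ω hω
      obtain ⟨n, hn⟩ := exists_nat_one_div_lt (neg_pos.2 (show X ω < 0 from hω))
      exact mem_iUnion.2 ⟨n, by simp only [mem_ofPred_eq]; linarith⟩
    refine measure_mono_null hU (measure_iUnion_null fun n => ?_)
    rw [← ofReal_cdf_map hXm, ENNReal.ofReal_eq_zero]
    exact hc _ (by positivity)
  have h1 : Tendsto (fun n : ℕ => ∫ x in Ioi (0 : ℝ), (1 - distortedCDF P (Ψ n) X x)) atTop
      (𝓝 (∫ x in Ioi (0 : ℝ), (0 : ℝ))) := by
    refine tendsto_integral_of_dominated_convergence (fun x => 1 - distortedCDF P (Ψ 0) X x)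
      (fun n => (by fun_prop : Measurable _).aestronglyMeasurable)
      (integrableOn_one_sub_distortedCDF (hX 0).integrable)
      (fun n => Eventually.of_forall fun x => ?_) ?_
    · rw [Real.norm_of_nonneg (sub_nonneg.2 (distortedCDF_mem_Icc _ _ _ _).2)]
      exact sub_le_sub_left (hΨ.mono zero_le (cdf_mem_Icc _ _)) _
    · filter_upwards [ae_restrict_mem measurableSet_Ioi] with x hx
      have hx' : 0 < cdf (P.map X) x :=
        hF.trans_le (monotone_cdf _ (by linarith [mem_Ioi.1 hx]))
      have := (hΨ.tendsto_natCast hs ⟨hx', cdf_le_one _ _⟩).const_sub 1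
      rwa [sub_self] at this
  rw [integral_zero] at h1
  obtain ⟨n, hn⟩ := (h1.eventually_lt_const (mul_pos hε hF)).exists
  refine ⟨n, ?_⟩
  rw [(hX n).utility_eq, sub_neg]
  refine hn.trans_le ?_
  calc ε * cdf (P.map X) (-ε) = ∫ x in Ioc 0 ε, cdf (P.map X) (-ε) := by
        simp [hε.le]
    _ ≤ ∫ x in Ioc 0 ε, distortedCDF P (Ψ n) X (-x) := by
        refine setIntegral_mono_on (by simp) ((hX n).integrableOn.mono_set Ioc_subset_Ioi_self)
          measurableSet_Ioc fun x hx => ?_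
        exact (monotone_cdf _ (neg_le_neg hx.2)).trans (cdf_le_distortedCDF _)
    _ ≤ ∫ x in Ioi 0, distortedCDF P (Ψ n) X (-x) :=
        setIntegral_mono_set (hX n).integrableOn
          (Eventually.of_forall fun x => (distortedCDF_mem_Icc _ _ _ _).1)
          Ioc_subset_Ioi_self.eventuallyLE

end Time

/-! ### Concave distortions as mixtures of truncations -/

section LevelLength

/-- The length of the set of points of `(0,1)` at which `g` exceeds `y`. -/
def levelLength (g : ℝ → ℝ) (y : ℝ) : ℝ := volume.real ({u | y < g u} ∩ Ioo 0 1)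

variable {g : ℝ → ℝ}

theorem measure_inter_Ioo_ne_top (s : Set ℝ) (a b : ℝ) : volume (s ∩ Ioo a b) ≠ ⊤ :=
  measure_ne_top_of_subset inter_subset_right (by simp)

theorem levelLength_anti : Antitone (levelLength g) := fun _ _ h =>
  measureReal_mono (inter_subset_inter_left _ fun _ hu => h.trans_lt hu)
    (measure_inter_Ioo_ne_top _ _ _)

theorem levelLength_nonneg (y : ℝ) : 0 ≤ levelLength g y := measureReal_nonneg

theorem levelLength_le_one (y : ℝ) : levelLength g y ≤ 1 :=
  (measureReal_mono inter_subset_right (by simp)).trans (by simp)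

theorem le_levelLength (hg : AntitoneOn g (Ioo 0 1)) {u y : ℝ} (hu : u ∈ Ioo (0 : ℝ) 1)
    (h : y < g u) : u ≤ levelLength g y := by
  have hsub : Ioo 0 u ⊆ {u | y < g u} ∩ Ioo 0 1 := fun v hv =>
    ⟨h.trans_le (hg ⟨hv.1, hv.2.trans hu.2⟩ hu hv.2.le), hv.1, hv.2.trans hu.2⟩
  have := measureReal_mono hsub (measure_inter_Ioo_ne_top _ _ _) (μ := volume)
  rw [levelLength]
  simpa [hu.1.le] using this

theorem inter_Ioo_subset (hg : AntitoneOn g (Ioo 0 1)) {u y : ℝ} (hu : u ∈ Ioo (0 : ℝ) 1)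
    (h : g u ≤ y) : {u | y < g u} ∩ Ioo 0 1 ⊆ Ioo 0 u := fun _ hv =>
  ⟨hv.2.1, not_le.1 fun huv => absurd (hg hu hv.2 huv) (not_le.2 (h.trans_lt hv.1))⟩

theorem levelLength_le (hg : AntitoneOn g (Ioo 0 1)) {u y : ℝ} (hu : u ∈ Ioo (0 : ℝ) 1)
    (h : g u ≤ y) : levelLength g y ≤ u :=
  (measureReal_mono (inter_Ioo_subset hg hu h) (by simp)).trans (by simp [hu.1.le])

/-- For decreasing `g` the superlevel set is an initial interval of `(0,1)`, so cutting at `p`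
truncates its length. This is how `min p c` enters when the layer-cake formula is applied to the
derivative of `Ψ`. -/
theorem volume_real_inter_Ioo (hg : AntitoneOn g (Ioo 0 1)) {p : ℝ} (hp : p ∈ Ioc (0 : ℝ) 1)
    (y : ℝ) : volume.real ({u | y < g u} ∩ Ioo 0 p) = min p (levelLength g y) := by
  have hpsub : Ioo 0 p ⊆ Ioo (0 : ℝ) 1 := Ioo_subset_Ioo_right hp.2
  by_cases h : ∀ u ∈ Ioo 0 p, y < g u
  · have h1 : {u | y < g u} ∩ Ioo 0 p = Ioo 0 p := inter_eq_right.2 h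
    have h2 : p ≤ levelLength g y := by
      have := measureReal_mono (inter_subset_inter_right {u | y < g u} hpsub)
        (measure_inter_Ioo_ne_top _ _ _) (μ := volume)
      rw [h1] at this
      rw [levelLength]
      simpa [hp.1.le] using this
    rw [h1, min_eq_left h2]
    simp [hp.1.le]
  · push Not at h
    obtain ⟨u, hu, hy⟩ := h
    have h1 : {u | y < g u} ∩ Ioo 0 p = {u | y < g u} ∩ Ioo 0 1 := by
      refine (inter_subset_inter_right _ hpsub).antisymm fun v hv => ⟨hv.1, hv.2.1, ?_⟩
      exact (inter_Ioo_subset hg (hpsub hu) hy hv).2.trans hu.2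
    rw [h1, min_eq_right ((levelLength_le hg (hpsub hu) hy).trans hu.2.le), levelLength]

theorem integral_eq_integral_min (hg : AntitoneOn g (Ioo 0 1)) (h0 : ∀ u ∈ Ioo (0 : ℝ) 1, 0 ≤ g u)
    (hint : IntegrableOn g (Ioo 0 1)) {p : ℝ} (hp : p ∈ Ioc (0 : ℝ) 1) :
    ∫ u in Ioo 0 p, g u = ∫ y in Ioi 0, min p (levelLength g y) := by
  have hpsub : Ioo 0 p ⊆ Ioo (0 : ℝ) 1 := Ioo_subset_Ioo_right hp.2
  rw [Integrable.integral_eq_integral_meas_lt (hint.mono_set hpsub)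
    ((ae_restrict_mem measurableSet_Ioo).mono fun u hu => h0 u (hpsub hu))]
  refine setIntegral_congr_fun measurableSet_Ioi fun y _ => ?_
  rw [← volume_real_inter_Ioo hg hp, measureReal_def, Measure.restrict_apply' measurableSet_Ioo,
    measureReal_def]

theorem integrableOn_levelLength (h0 : ∀ u ∈ Ioo (0 : ℝ) 1, 0 ≤ g u)
    (hint : IntegrableOn g (Ioo 0 1)) : IntegrableOn (levelLength g) (Ioi 0) := by
  rw [integrableOn_iff_lintegral_ne_top levelLength_anti.measurable levelLength_nonneg]
  refine ne_top_of_le_ne_top hint.lintegral_lt_top.ne (le_of_eq ?_)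
  rw [lintegral_eq_lintegral_meas_lt _
    ((ae_restrict_mem measurableSet_Ioo).mono fun u hu => h0 u hu) hint.aemeasurable]
  refine setLIntegral_congr_fun measurableSet_Ioi fun y _ => ?_
  rw [Measure.restrict_apply' measurableSet_Ioo, levelLength,
    ofReal_measureReal (measure_inter_Ioo_ne_top _ _ _)]

end LevelLength

/-- `Ψ` is the mixture of the distortions `p ↦ min p c`, `c = level y`, up to a jump at zero. -/
structure IsMixture (Ψ : ConcaveDistortion) (jump : ℝ) (level : ℝ → ℝ) : Prop where
  jump_nonneg : 0 ≤ jump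
  jump_le : ∀ p ∈ Ioc (0 : ℝ) 1, jump ≤ Ψ p
  measurable : Measurable level
  level_nonneg : ∀ y, 0 ≤ level y
  level_le_one : ∀ y, level y ≤ 1
  integrableOn : IntegrableOn level (Ioi 0)
  eq : ∀ p ∈ Icc (0 : ℝ) 1,
    Ψ p = (if 0 < p then jump else 0) + ∫ y in Ioi 0, min p (level y)

theorem IsMixture.integral_level {Ψ : ConcaveDistortion} {a : ℝ} {c : ℝ → ℝ}
    (h : IsMixture Ψ a c) : 1 = a + ∫ y in Ioi 0, c y := by
  have := h.eq 1 (right_mem_Icc.2 zero_le_one)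
  simp only [Ψ.map_one, zero_lt_one, if_true, min_eq_right (h.level_le_one _)] at this
  exact this

/-- Every concave distortion is a mixture; if it is strictly concave, then the levels that are
used are dense. -/
theorem exists_isMixture (Ψ : ConcaveDistortion) : ∃ jump level, IsMixture Ψ jump level ∧
    (StrictConcaveOn ℝ (Icc 0 1) Ψ → ∀ c₁ c₂ : ℝ, 0 < c₁ → c₁ < c₂ → c₂ < 1 →
      ∃ l u : ℝ, 0 ≤ l ∧ l < u ∧ ∀ y ∈ Ioo l u, level y ∈ Icc c₁ c₂) := by
  -- The levels are the superlevel lengths of the right derivative `g` of `Ψ`, reached through the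
  -- convex function `-Ψ`; the jump will be `Ψ(0+)`.
  set k : ℝ → ℝ := fun x => derivWithin (-⇑Ψ) (Ioi x) x with hk
  set g : ℝ → ℝ := fun x => -k x with hgdef
  have hconv : ConvexOn ℝ (Icc 0 1) (-⇑Ψ) := Ψ.concaveOn.neg
  have hint01 : ∀ x ∈ Ioo (0 : ℝ) 1, x ∈ interior (Icc (0 : ℝ) 1) := fun x hx => by
    rwa [interior_Icc]
  have hder : ∀ x ∈ Ioo (0 : ℝ) 1, HasDerivWithinAt Ψ (g x) (Ioi x) x := fun x hx => by
    have := (hconv.hasDerivWithinAt_rightDeriv_of_mem_interior (hint01 x hx)).neg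
    simpa using this
  have hanti : AntitoneOn g (Ioo 0 1) := fun x hx y hy hxy =>
    neg_le_neg (hconv.monotoneOn_rightDeriv (hint01 x hx) (hint01 y hy) hxy)
  have hg0 : ∀ x ∈ Ioo (0 : ℝ) 1, 0 ≤ g x := fun x hx => by
    have h1 := hconv.rightDeriv_le_slope (Ioo_subset_Icc_self hx) (right_mem_Icc.2 zero_le_one)
      hx.2 (hconv.hasDerivWithinAt_rightDeriv_of_mem_interior (hint01 x hx)).differentiableWithinAt
    have h2 : slope (-⇑Ψ) x 1 ≤ 0 := by
      rw [slope_def_field]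
      refine div_nonpos_of_nonpos_of_nonneg ?_ (by linarith [hx.2])
      have := Ψ.le_one (Ioo_subset_Icc_self hx)
      simp only [Pi.neg_apply, Ψ.map_one]
      linarith
    exact neg_nonneg.2 (h1.trans h2)
  set a : ℝ := sInf (Ψ '' Ioo 0 1) with ha
  have hne : (Ioo (0 : ℝ) 1).Nonempty := nonempty_Ioo.2 zero_lt_one
  have hbdd : BddBelow (Ψ '' Ioo 0 1) :=
    ⟨0, by rintro _ ⟨x, hx, rfl⟩; exact (Ψ.mem_Icc (Ioo_subset_Icc_self hx)).1⟩
  have ha0 : 0 ≤ a := le_csInf (hne.image _)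
    (by rintro _ ⟨x, hx, rfl⟩; exact (Ψ.mem_Icc (Ioo_subset_Icc_self hx)).1)
  have hale' : ∀ p ∈ Ioo (0 : ℝ) 1, a ≤ Ψ p := fun p hp => csInf_le hbdd (mem_image_of_mem _ hp)
  have hale : ∀ p ∈ Ioc (0 : ℝ) 1, a ≤ Ψ p := fun p hp =>
    (hale' (p / 2) ⟨by linarith [hp.1], by linarith [hp.2]⟩).trans
      (Ψ.monotoneOn ⟨by linarith [hp.1], by linarith [hp.2]⟩ ⟨hp.1.le, hp.2⟩ (by linarith [hp.1]))
  have hlim : Tendsto Ψ (𝓝[>] 0) (𝓝 a) :=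
    (Ψ.monotoneOn.mono Ioo_subset_Icc_self).tendsto_nhdsWithin_Ioo_right hne hbdd
  -- Replacing the value at zero by the right limit gives continuity on `[0,1]`, as the fundamental
  -- theorem of calculus requires.
  set f : ℝ → ℝ := Function.update Ψ 0 a with hf
  have hfeq : ∀ x, x ≠ 0 → f x = Ψ x := fun x hx => Function.update_of_ne hx _ _
  have hf0 : f 0 = a := Function.update_self _ _ _
  have hfcont : ContinuousOn f (Icc 0 1) := by
    intro x hx
    rcases hx.1.eq_or_lt with rfl | hx0
    · rw [hf, continuousWithinAt_update_same]
      refine hlim.mono_left (nhdsWithin_mono _ fun y hy => ?_)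
      exact lt_of_le_of_ne hy.1.1 (Ne.symm hy.2)
    · have h1 : ContinuousWithinAt Ψ (Ioc 0 1) x := Ψ.continuousOn_Ioc x ⟨hx0, hx.2⟩
      have h2 : ContinuousWithinAt f (Ioc 0 1) x :=
        h1.congr (fun y hy => hfeq y hy.1.ne') (hfeq x hx0.ne')
      refine h2.mono_of_mem_nhdsWithin ?_
      rw [mem_nhdsWithin]
      exact ⟨Ioi 0, isOpen_Ioi, hx0, fun y hy => ⟨hy.1, hy.2.2⟩⟩
  have hfder : ∀ x ∈ Ioo (0 : ℝ) 1, HasDerivWithinAt f (g x) (Ioi x) x := fun x hx =>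
    (hder x hx).congr (fun y hy => hfeq y (hx.1.trans hy).ne') (hfeq x hx.1.ne')
  have hgint : IntegrableOn g (Ioo 0 1) :=
    (intervalIntegral.integrableOn_deriv_right_of_nonneg hfcont hfder hg0).mono_set
      Ioo_subset_Ioc_self
  have hftc : ∀ p ∈ Ioc (0 : ℝ) 1, Ψ p = a + ∫ u in Ioo 0 p, g u := by
    intro p hp
    have hint : IntervalIntegrable g volume 0 p := by
      rw [intervalIntegrable_iff_integrableOn_Ioo_of_le hp.1.le]
      exact hgint.mono_set (Ioo_subset_Ioo_right hp.2)
    have := intervalIntegral.integral_eq_sub_of_hasDeriv_right_of_le hp.1.le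
      (hfcont.mono (Icc_subset_Icc_right hp.2))
      (fun x hx => hfder x ⟨hx.1, hx.2.trans_le hp.2⟩) hint
    rw [intervalIntegral.integral_of_le hp.1.le, integral_Ioc_eq_integral_Ioo, hf0,
      hfeq p hp.1.ne'] at this
    rw [this]
    ring
  refine ⟨a, levelLength g, ⟨ha0, hale, levelLength_anti.measurable, levelLength_nonneg,
    levelLength_le_one, integrableOn_levelLength hg0 hgint, fun p hp => ?_⟩, ?_⟩
  · rcases hp.1.eq_or_lt with rfl | hp0
    · simp [Ψ.map_zero, min_eq_left (levelLength_nonneg _)]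
    · rw [hftc p ⟨hp0, hp.2⟩, integral_eq_integral_min hanti hg0 hgint ⟨hp0, hp.2⟩, if_pos hp0]
  · intro hs c₁ c₂ h1 h12 h2
    have hm1 : c₁ ∈ Ioo (0 : ℝ) 1 := ⟨h1, h12.trans h2⟩
    have hm2 : c₂ ∈ Ioo (0 : ℝ) 1 := ⟨h1.trans h12, h2⟩
    -- Strict concavity makes `g` drop strictly between `c₁` and `c₂`; every height in this gap has
    -- its level in `[c₁, c₂]`.
    have hlt : g c₂ < g c₁ := by
      have e1 := (hs.neg).rightDeriv_lt_slope (Ioo_subset_Icc_self hm1) (Ioo_subset_Icc_self hm2)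
        h12 (hconv.hasDerivWithinAt_rightDeriv_of_mem_interior
          (hint01 _ hm1)).differentiableWithinAt
      have e2 := hconv.slope_le_leftDeriv_of_mem_interior (Ioo_subset_Icc_self hm1)
        (hint01 _ hm2) h12
      have e3 := hconv.leftDeriv_le_rightDeriv_of_mem_interior (hint01 _ hm2)
      exact neg_lt_neg (e1.trans_le (e2.trans e3))
    exact ⟨g c₂, g c₁, hg0 _ hm2, hlt, fun y hy =>
      ⟨le_levelLength hanti hm1 hy.2, levelLength_le hanti hm2 hy.1.le⟩⟩

/-! ### Tail utilities and their variational formula -/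

section TailUtility

theorem integrable_indicator_Ioi_sub_Ici (s c : ℝ) :
    Integrable (fun x => (if 0 < x then c else 0) - if s ≤ x then c else 0) ∧
    ∫ x, ((if 0 < x then c else 0) - if s ≤ x then c else 0) = s * c := by
  rcases lt_or_ge 0 s with hs | hs
  · have h : (fun x : ℝ => (if 0 < x then c else 0) - if s ≤ x then c else 0)
        = (Ioo 0 s).indicator fun _ => c := by
      ext x
      by_cases h1 : 0 < x
      · by_cases h2 : s ≤ x
        · simp [h1, h2]
        · simp [h1, h2, not_le.1 h2]
      · have h2 : ¬ s ≤ x := fun h2 => h1 (hs.trans_le h2)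
        simp [h1, h2]
    rw [h]
    refine ⟨(integrable_indicator_iff measurableSet_Ioo).2 (by simp), ?_⟩
    rw [integral_indicator measurableSet_Ioo]
    simp [hs.le]
  · have h : (fun x : ℝ => (if 0 < x then c else 0) - if s ≤ x then c else 0)
        = (Icc s 0).indicator fun _ => -c := by
      ext x
      by_cases h1 : 0 < x
      · have h2 : s ≤ x := hs.trans h1.le
        simp [h1, h2]
      · by_cases h2 : s ≤ x
        · simp [h1, h2, not_lt.1 h1]
        · simp [h1, h2]
    rw [h]
    refine ⟨(integrable_indicator_iff measurableSet_Icc).2 (by simp), ?_⟩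
    rw [integral_indicator measurableSet_Icc]
    simp [hs]

variable {Ω : Type*} [MeasurableSpace Ω] (P : Measure Ω) (c : ℝ) (X : Ω → ℝ)

/-- The integrand of `tailUtility`. -/
def tailDensity (x : ℝ) : ℝ := (if 0 < x then c else 0) - min (cdf (P.map X) x) c

/-- The distorted expectation for the truncation `p ↦ min p c`, that is, the integral of the
quantile function of `X` over `(0,c)`. -/
def tailUtility : ℝ := ∫ x, tailDensity P c X x

/-- `s` is a `c`-quantile of `X`. -/
def IsQuantile (s : ℝ) : Prop :=
  (∀ x < s, cdf (P.map X) x < c) ∧ ∀ x, s ≤ x → c ≤ cdf (P.map X) x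

variable {P c X} {Y : Ω → ℝ}

theorem exists_isQuantile (h0 : 0 < c) (h1 : c < 1) : ∃ s, IsQuantile P c X s := by
  set F := cdf (P.map X)
  set A : Set ℝ := {x | c ≤ F x}
  have hne : A.Nonempty := by
    obtain ⟨x, hx⟩ := ((tendsto_cdf_atTop (P.map X)).eventually (lt_mem_nhds h1)).exists
    exact ⟨x, hx.le⟩
  have hbdd : BddBelow A := by
    obtain ⟨x, hx⟩ := ((tendsto_cdf_atBot (P.map X)).eventually (gt_mem_nhds h0)).exists
    refine ⟨x, fun y hy => ?_⟩
    by_contra! hyx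
    exact absurd (hy.trans (F.mono hyx.le)) (not_le.2 hx)
  refine ⟨sInf A, fun x hx => not_le.1 fun h => absurd (csInf_le hbdd h) (not_le.2 hx), ?_⟩
  have hs : c ≤ F (sInf A) := by
    rw [← F.iInf_Ioi_eq]
    refine le_ciInf fun r => ?_
    obtain ⟨x, hx, hxr⟩ := exists_lt_of_csInf_lt hne r.2
    exact le_trans hx (F.mono hxr.le)
  exact fun x hx => hs.trans (F.mono hx)

variable [IsProbabilityMeasure P]

@[fun_prop]
theorem measurable_cdf (μ : Measure ℝ) : Measurable fun x => cdf μ x :=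
  (monotone_cdf μ).measurable

theorem integrable_tailDensity (hX : Integrable X P) (h0 : 0 ≤ c) (h1 : c ≤ 1) :
    Integrable (tailDensity P c X) := by
  refine (admissible_id hX).integrable_density.mono ?_ (Eventually.of_forall fun x => ?_)
  · refine Measurable.aestronglyMeasurable ?_
    unfold tailDensity
    exact (Measurable.ite measurableSet_Ioi measurable_const measurable_const).sub (by fun_prop)
  · have hF := cdf_mem_Icc (P.map X) x
    by_cases hx : 0 < x
    · rw [utilityDensity_of_pos hx, tailDensity, if_pos hx, distortedCDF_id,
        Real.norm_of_nonneg (sub_nonneg.2 (min_le_right _ _)),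
        Real.norm_of_nonneg (sub_nonneg.2 hF.2)]
      rcases le_total (cdf (P.map X) x) c with h | h
      · rw [min_eq_left h]; linarith
      · rw [min_eq_right h]; linarith [hF.2]
    · rw [utilityDensity_of_nonpos (not_lt.1 hx), tailDensity, if_neg hx, distortedCDF_id,
        zero_sub, norm_neg, norm_neg, Real.norm_of_nonneg (le_min hF.1 h0),
        Real.norm_of_nonneg hF.1]
      exact min_le_left _ _

theorem integrable_max_sub (hX : Integrable X P) (s : ℝ) :
    Integrable (fun ω => max (s - X ω) 0) P := ((integrable_const s).sub hX).pos_part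

theorem integrable_indicator_cdf (hX : Integrable X P) (s : ℝ) :
    Integrable ((Iio s).indicator fun x => cdf (P.map X) x) ∧
    ∫ x, (Iio s).indicator (fun x => cdf (P.map X) x) x = ∫ ω, max (s - X ω) 0 ∂P := by
  set G : ℝ → ℝ := (Ioi (0 : ℝ)).indicator fun t => cdf (P.map X) (s - t) with hG
  have hGF : (Iio s).indicator (fun x => cdf (P.map X) x) = fun x => G (s - x) := by
    ext x
    by_cases hx : x < s
    · rw [hG, indicator_of_mem (mem_Iio.2 hx), indicator_of_mem (mem_Ioi.2 (sub_pos.2 hx)),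
        sub_sub_cancel]
    · rw [hG, indicator_of_notMem (by simpa using hx), indicator_of_notMem (by simpa using hx)]
  have hsX : Integrable (fun ω => s - X ω) P := (integrable_const s).sub hX
  have hmax : ∀ ω, ENNReal.ofReal (s - X ω) = ENNReal.ofReal (max (s - X ω) 0) := fun ω => by
    rcases le_total (s - X ω) 0 with h | h <;> simp [h, ENNReal.ofReal_of_nonpos]
  have hl := lintegral_cdf_sub hX.aemeasurable s
  have hint : IntegrableOn (fun t => cdf (P.map X) (s - t)) (Ioi 0) := by
    rw [integrableOn_iff_lintegral_ne_top (by fun_prop) (fun x => cdf_nonneg _ _), hl]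
    exact hsX.lintegral_lt_top.ne
  have hGint : Integrable G := (integrable_indicator_iff measurableSet_Ioi).2 hint
  rw [hGF]
  refine ⟨hGint.comp_sub_left s, ?_⟩
  rw [integral_sub_left_eq_self, hG, integral_indicator measurableSet_Ioi,
    integral_eq_lintegral_of_nonneg_ae (Eventually.of_forall fun x => cdf_nonneg _ _)
      hint.aestronglyMeasurable, hl,
    integral_eq_lintegral_of_nonneg_ae (f := fun ω => max (s - X ω) 0)
      (Eventually.of_forall fun ω => le_max_right (s - X ω) 0)
      (integrable_max_sub hX s).aestronglyMeasurable]
  simp only [hmax]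

/-- The integrand that compares `tailUtility` with the expected shortfall below `s`. -/
theorem integral_shortfall (hX : Integrable X P) (c s : ℝ) :
    Integrable (fun x => ((if 0 < x then c else 0) - if s ≤ x then c else 0)
      - (Iio s).indicator (fun x => cdf (P.map X) x) x) ∧
    ∫ x, (((if 0 < x then c else 0) - if s ≤ x then c else 0)
      - (Iio s).indicator (fun x => cdf (P.map X) x) x) = s * c - ∫ ω, max (s - X ω) 0 ∂P := by
  obtain ⟨h1, h2⟩ := integrable_indicator_Ioi_sub_Ici s c
  obtain ⟨h3, h4⟩ := integrable_indicator_cdf hX s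
  exact ⟨h1.sub h3, by rw [integral_sub h1 h3, h2, h4]⟩

/-- Bound `min D c` by `D` below `s` and by `c` from `s` on. Both bounds are equalities at a
`c`-quantile, so for `0 < c < 1` the tail utility is the maximum over `s` of `s c - E (s - X)⁺`. -/
theorem shortfall_le_tailUtility (hX : Integrable X P) (h0 : 0 ≤ c) (h1 : c ≤ 1) (s : ℝ) :
    s * c - ∫ ω, max (s - X ω) 0 ∂P ≤ tailUtility P c X := by
  obtain ⟨h2, h3⟩ := integral_shortfall hX c s
  rw [← h3]
  refine integral_mono h2 (integrable_tailDensity hX h0 h1) fun x => ?_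
  simp only [tailDensity]
  rcases lt_or_ge x s with hx | hx
  · rw [indicator_of_mem (mem_Iio.2 hx), if_neg (not_le.2 hx), sub_zero]
    exact sub_le_sub_left (min_le_left _ _) _
  · rw [indicator_of_notMem (by simpa using hx), if_pos hx, sub_zero]
    exact sub_le_sub_left (min_le_right _ _) _

theorem IsQuantile.tailUtility_eq {s : ℝ} (hs : IsQuantile P c X s) (hX : Integrable X P) :
    tailUtility P c X = s * c - ∫ ω, max (s - X ω) 0 ∂P := by
  rw [← (integral_shortfall hX c s).2, tailUtility]
  congr 1
  ext x
  simp only [tailDensity]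
  rcases lt_or_ge x s with hx | hx
  · rw [indicator_of_mem (mem_Iio.2 hx), if_neg (not_le.2 hx), sub_zero,
      min_eq_left (hs.1 x hx).le]
  · rw [indicator_of_notMem (by simpa using hx), if_pos hx, sub_zero, min_eq_right (hs.2 x hx)]

omit [IsProbabilityMeasure P] in
theorem tailUtility_zero : tailUtility P 0 X = 0 := by
  simp [tailUtility, tailDensity, min_eq_right (cdf_nonneg _ _)]

theorem tailUtility_one (hX : Integrable X P) : tailUtility P 1 X = ∫ ω, X ω ∂P := by
  rw [← utility_id hX, tailUtility, utility]
  congr 1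
  ext x
  rw [tailDensity, utilityDensity, min_eq_left (cdf_le_one _ _), distortedCDF_id]
  rfl

theorem max_add_le (a b : ℝ) : max (a + b) 0 ≤ max a 0 + max b 0 :=
  max_le (add_le_add (le_max_left _ _) (le_max_left _ _))
    (add_nonneg (le_max_right _ _) (le_max_right _ _))

/-- Insert the sum of the two quantiles into the variational bound for `X + Y` and use subadditivity
of the positive part. The endpoint levels, where quantiles may fail to exist, give zero and the
mean. -/
theorem tailUtility_add_le (hX : Integrable X P) (hY : Integrable Y P) (h0 : 0 ≤ c)
    (h1 : c ≤ 1) :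
    tailUtility P c X + tailUtility P c Y ≤ tailUtility P c fun ω => X ω + Y ω := by
  have hXY : Integrable (fun ω => X ω + Y ω) P := hX.add hY
  rcases h0.eq_or_lt with rfl | h0'
  · simp [tailUtility_zero]
  rcases h1.eq_or_lt with rfl | h1'
  · rw [tailUtility_one hX, tailUtility_one hY, tailUtility_one hXY,
      integral_add hX hY]
  obtain ⟨s, hs⟩ := exists_isQuantile (P := P) (X := X) h0' h1'
  obtain ⟨r, hr⟩ := exists_isQuantile (P := P) (X := Y) h0' h1'
  rw [hs.tailUtility_eq hX, hr.tailUtility_eq hY]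
  refine le_trans ?_ (shortfall_le_tailUtility hXY h0 h1 (s + r))
  have : ∫ ω, max (s + r - (X ω + Y ω)) 0 ∂P
      ≤ ∫ ω, (max (s - X ω) 0 + max (r - Y ω) 0) ∂P := by
    refine integral_mono (integrable_max_sub hXY _)
      ((integrable_max_sub hX s).add (integrable_max_sub hY r)) fun ω => ?_
    have := max_add_le (s - X ω) (r - Y ω)
    rwa [show s - X ω + (r - Y ω) = s + r - (X ω + Y ω) by ring] at this
  rw [integral_add (integrable_max_sub hX s) (integrable_max_sub hY r)] at this
  linarith

/-- If the tail utility is additive at level `c`, then the two variables lie almost surely on the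
same side of their `c`-quantiles. -/
theorem exists_isQuantile_of_tailUtility_add (hX : Integrable X P) (hY : Integrable Y P)
    (h0 : 0 < c) (h1 : c < 1)
    (h : tailUtility P c X + tailUtility P c Y = tailUtility P c fun ω => X ω + Y ω) :
    ∃ s r, IsQuantile P c X s ∧ IsQuantile P c Y r ∧
      ∀ᵐ ω ∂P, (X ω < s → Y ω ≤ r) ∧ (Y ω < r → X ω ≤ s) := by
  have hXY : Integrable (fun ω => X ω + Y ω) P := hX.add hY
  obtain ⟨s, hs⟩ := exists_isQuantile (P := P) (X := X) h0 h1
  obtain ⟨r, hr⟩ := exists_isQuantile (P := P) (X := Y) h0 h1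
  refine ⟨s, r, hs, hr, ?_⟩
  rw [hs.tailUtility_eq hX, hr.tailUtility_eq hY] at h
  have hle := shortfall_le_tailUtility hXY h0.le h1.le (s + r)
  have hintX := integrable_max_sub hX s
  have hintY := integrable_max_sub hY r
  have hintZ := integrable_max_sub hXY (s + r)
  have hnn : ∀ ω, 0 ≤ max (s - X ω) 0 + max (r - Y ω) 0 - max (s + r - (X ω + Y ω)) 0 := fun ω => by
    have := max_add_le (s - X ω) (r - Y ω)
    rw [show s - X ω + (r - Y ω) = s + r - (X ω + Y ω) by ring] at this
    exact sub_nonneg.2 this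
  -- Additivity annihilates the nonnegative defect of `(a + b)⁺ ≤ a⁺ + b⁺`; the defect is positive
  -- when `a` and `b` have strictly opposite signs.
  have hzero : ∫ ω, (max (s - X ω) 0 + max (r - Y ω) 0 - max (s + r - (X ω + Y ω)) 0) ∂P = 0 := by
    refine le_antisymm ?_ (integral_nonneg hnn)
    have hi : Integrable (fun ω => max (s - X ω) 0 + max (r - Y ω) 0) P := hintX.add hintY
    rw [integral_sub hi hintZ, integral_add hintX hintY]
    linarith
  rw [integral_eq_zero_iff_of_nonneg hnn ((hintX.add hintY).sub hintZ)] at hzero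
  filter_upwards [hzero] with ω hω
  simp only [Pi.zero_apply] at hω
  constructor
  · intro h1
    by_contra! h2
    rw [max_eq_left (by linarith : 0 ≤ s - X ω), max_eq_right (by linarith : r - Y ω ≤ 0)] at hω
    rcases max_cases (s + r - (X ω + Y ω)) 0 with h | h <;> linarith
  · intro h1
    by_contra! h2
    rw [max_eq_left (by linarith : 0 ≤ r - Y ω), max_eq_right (by linarith : s - X ω ≤ 0)] at hω
    rcases max_cases (s + r - (X ω + Y ω)) 0 with h | h <;> linarith

end TailUtility

/-! ### Superadditivity of the utility and its equality case -/

section Superadditivity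

variable {Ω : Type*} [MeasurableSpace Ω] {P : Measure Ω} [IsProbabilityMeasure P]
  {Ψ : ConcaveDistortion} {X Y : Ω → ℝ} {a : ℝ} {c : ℝ → ℝ}

/-- `m` is the essential infimum of `X`, in terms of the distribution function. -/
def IsCdfInf (P : Measure Ω) (X : Ω → ℝ) (m : ℝ) : Prop :=
  (∀ x < m, cdf (P.map X) x = 0) ∧ ∀ x, m < x → 0 < cdf (P.map X) x

omit [IsProbabilityMeasure P] in
-- If `X` were unbounded below, the jump would keep `Ψ(D_X)` at least `a > 0` on the whole line,
-- against integrability near `-∞`.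
theorem IsMixture.exists_isCdfInf (h : IsMixture Ψ a c) (ha : 0 < a) (hX : Admissible P Ψ X) :
    ∃ m, IsCdfInf P X m := by
  set F := cdf (P.map X)
  set A : Set ℝ := {x | 0 < F x}
  have hne : A.Nonempty := by
    obtain ⟨x, hx⟩ := ((tendsto_cdf_atTop (P.map X)).eventually (lt_mem_nhds one_pos)).exists
    exact ⟨x, hx⟩
  have hbdd : BddBelow A := by
    by_contra hnb
    have hall : ∀ x, 0 < F x := fun x => by
      obtain ⟨y, hy, hyx⟩ := not_bddBelow_iff.1 hnb x
      exact lt_of_lt_of_le hy (F.mono hyx.le)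
    have hconst : IntegrableOn (fun _ : ℝ => a) (Ioi 0) :=
      hX.integrableOn.mono' aestronglyMeasurable_const (Eventually.of_forall fun x => by
        rw [Real.norm_of_nonneg ha.le]
        exact h.jump_le _ ⟨hall _, cdf_le_one _ _⟩)
    rw [integrableOn_const_iff] at hconst
    simp [ha.ne'] at hconst
  refine ⟨sInf A, fun x hx => ?_, fun x hx => ?_⟩
  · refine le_antisymm (not_lt.1 fun h => absurd (csInf_le hbdd h) (not_le.2 hx)) (cdf_nonneg _ _)
  · obtain ⟨y, hy, hyx⟩ := exists_lt_of_csInf_lt hne hx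
    exact lt_of_lt_of_le hy (F.mono hyx.le)

theorem IsCdfInf.add_le {m n k : ℝ} (hm : IsCdfInf P X m) (hn : IsCdfInf P Y n)
    (hk : IsCdfInf P (fun ω => X ω + Y ω) k) (hX : AEMeasurable X P) (hY : AEMeasurable Y P) :
    m + n ≤ k := by
  by_contra! hlt
  set e := (m + n - k) / 4 with he
  have h := cdf_add_le hX hY (m - e) (n - e)
  rw [hm.1 _ (by linarith), hn.1 _ (by linarith), add_zero] at h
  exact absurd (hk.2 (m - e + (n - e)) (by linarith)) (not_lt.2 h)

omit [IsProbabilityMeasure P] in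
/-- The contribution of the jump at zero to the utility. -/
theorem IsMixture.jump_term (h : IsMixture Ψ a c) (hX : Admissible P Ψ X) :
    ∃ m, (0 < a → IsCdfInf P X m) ∧
      Integrable (fun x => (if 0 < x then a else 0) - if 0 < cdf (P.map X) x then a else 0) ∧
      ∫ x, ((if 0 < x then a else 0) - if 0 < cdf (P.map X) x then a else 0) = m * a := by
  rcases h.jump_nonneg.eq_or_lt with h0 | ha
  · exact ⟨0, fun h => absurd h0 h.ne, by simp [← h0]⟩
  · obtain ⟨m, hm⟩ := h.exists_isCdfInf ha hX
    obtain ⟨h1, h2⟩ := integrable_indicator_Ioi_sub_Ici m a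
    have hae : (fun x : ℝ => (if 0 < x then a else 0) - if m ≤ x then a else 0)
        =ᵐ[volume] fun x => (if 0 < x then a else 0) - if 0 < cdf (P.map X) x then a else 0 := by
      filter_upwards [(countable_singleton m).ae_notMem volume] with x hx
      rcases lt_or_gt_of_ne (show x ≠ m from hx) with hlt | hgt
      · rw [hm.1 x hlt, if_neg (not_le.2 hlt)]
        simp
      · rw [if_pos (hm.2 x hgt), if_pos hgt.le]
    exact ⟨m, fun _ => hm, h1.congr hae, by rw [← h2]; exact (integral_congr_ae hae).symm⟩

/-- The utility is a mixture of tail utilities, up to the contribution of the essential infimum. -/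
theorem IsMixture.utility_eq (h : IsMixture Ψ a c) (hX : Admissible P Ψ X) :
    ∃ m, (0 < a → IsCdfInf P X m) ∧
      IntegrableOn (fun y => tailUtility P (c y) X) (Ioi 0) ∧
      utility P Ψ X = m * a + ∫ y in Ioi 0, tailUtility P (c y) X := by
  obtain ⟨m, hm, hint, hval⟩ := h.jump_term hX
  refine ⟨m, hm, ?_⟩
  set F : ℝ → ℝ := fun x => cdf (P.map X) x with hFdef
  have hFm : Measurable F := measurable_cdf _
  have hF : ∀ x, F x ∈ Icc (0 : ℝ) 1 := fun x => cdf_mem_Icc _ _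
  have hsec : ∀ x, IntegrableOn (fun y => min (F x) (c y)) (Ioi 0) := fun x =>
    h.integrableOn.mono' (measurable_const.min h.measurable).aestronglyMeasurable
      (Eventually.of_forall fun y => by
        rw [Real.norm_of_nonneg (le_min (hF x).1 (h.level_nonneg y))]
        exact min_le_right _ _)
  have hsec' : ∀ x : ℝ, IntegrableOn (fun y => if 0 < x then c y else 0) (Ioi 0) := fun x => by
    by_cases hx : 0 < x
    · simpa [hx] using h.integrableOn
    · simp [hx]
  have hH : ∀ x, IntegrableOn (fun y => tailDensity P (c y) X x) (Ioi 0) := fun x =>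
    (hsec' x).sub (hsec x)
  have hHval : ∀ x, ∫ y in Ioi 0, tailDensity P (c y) X x = utilityDensity P Ψ X x
      - ((if 0 < x then a else 0) - if 0 < cdf (P.map X) x then a else 0) := by
    intro x
    have e1 : ∫ y in Ioi 0, tailDensity P (c y) X x
        = (∫ y in Ioi 0, if 0 < x then c y else 0) - ∫ y in Ioi 0, min (F x) (c y) :=
      integral_sub (hsec' x) (hsec x)
    rw [e1, utilityDensity, distortedCDF, h.eq _ (cdf_mem_Icc _ _)]
    by_cases hx : 0 < x
    · simp only [hx, if_true, indicator_of_mem (mem_Ioi.2 hx), Pi.one_apply]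
      linarith [h.integral_level]
    · simp only [hx, if_false, indicator_of_notMem (show x ∉ Ioi 0 from hx), integral_zero]
      ring
  -- For fixed `x` the density has one sign in `y`, so absolute integrability on the product, needed
  -- for Fubini, reduces to that of the inner integral.
  have hnorm : ∀ x, ∫ y in Ioi 0, ‖tailDensity P (c y) X x‖
      = ‖∫ y in Ioi 0, tailDensity P (c y) X x‖ := by
    intro x
    by_cases hx : 0 < x
    · have h0 : ∀ y, 0 ≤ tailDensity P (c y) X x := fun y => by
        rw [tailDensity, if_pos hx]
        exact sub_nonneg.2 (min_le_right _ _)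
      rw [Real.norm_of_nonneg (integral_nonneg h0)]
      simp only [Real.norm_of_nonneg (h0 _)]
    · have h0 : ∀ y, tailDensity P (c y) X x ≤ 0 := fun y => by
        rw [tailDensity, if_neg hx, zero_sub, neg_nonpos]
        exact le_min (hF x).1 (h.level_nonneg y)
      rw [Real.norm_of_nonpos (integral_nonpos h0)]
      simp only [Real.norm_of_nonpos (h0 _), integral_neg]
  have hmeas : Measurable (Function.uncurry fun x y => tailDensity P (c y) X x) := by
    unfold tailDensity Function.uncurry
    refine Measurable.sub (Measurable.ite (measurable_fst measurableSet_Ioi)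
      (h.measurable.comp measurable_snd) measurable_const) ?_
    exact (hFm.comp measurable_fst).min (h.measurable.comp measurable_snd)
  have hdens : Integrable (fun x => ∫ y in Ioi 0, tailDensity P (c y) X x) := by
    simp only [hHval]
    exact hX.integrable_density.sub hint
  have hprod : Integrable (Function.uncurry fun x y => tailDensity P (c y) X x)
      ((volume : Measure ℝ).prod (volume.restrict (Ioi 0))) := by
    rw [integrable_prod_iff hmeas.aestronglyMeasurable]
    refine ⟨Eventually.of_forall hH, ?_⟩
    simp only [Function.uncurry, hnorm]
    exact hdens.norm
  refine ⟨hprod.integral_prod_right, ?_⟩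
  have hswap := integral_integral_swap hprod
  have hu : utility P Ψ X = ∫ x, (((if 0 < x then a else 0) - if 0 < cdf (P.map X) x then a else 0)
      + ∫ y in Ioi 0, tailDensity P (c y) X x) := by
    rw [utility]
    congr 1
    ext x
    rw [hHval]
    ring
  rw [hu, integral_add hint hdens, hval, hswap]
  rfl

omit [IsProbabilityMeasure P] in
theorem IsQuantile.apply_le {v s : ℝ} (h : IsQuantile P v X s)
    (hc : Continuous fun x => cdf (P.map X) x) : cdf (P.map X) s ≤ v := by
  have hcl : IsClosed {x | cdf (P.map X) x ≤ v} := isClosed_le hc continuous_const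
  have hsub : closure (Iio s) ⊆ {x | cdf (P.map X) x ≤ v} :=
    hcl.closure_subset_iff.2 fun x hx => (h.1 x hx).le
  rw [closure_Iio] at hsub
  exact hsub self_mem_Iic

/-- The utility is superadditive; for a strictly concave distortion and continuously distributed
variables, it is additive only if the variables are comonotone. -/
theorem utility_superadditive (hX : Admissible P Ψ X) (hY : Admissible P Ψ Y) :
    utility P Ψ X + utility P Ψ Y ≤ utility P Ψ (fun ω => X ω + Y ω) ∧
    (StrictConcaveOn ℝ (Icc 0 1) Ψ → Continuous (fun x => cdf (P.map X) x) →
      Continuous (fun x => cdf (P.map Y) x) →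
      utility P Ψ X + utility P Ψ Y = utility P Ψ (fun ω => X ω + Y ω) →
      ∀ᵐ ω ∂P, cdf (P.map X) (X ω) = cdf (P.map Y) (Y ω)) := by
  obtain ⟨a, c, h, hdense⟩ := exists_isMixture Ψ
  obtain ⟨m, hm, hmi, hmu⟩ := h.utility_eq hX
  obtain ⟨n, hn, hni, hnu⟩ := h.utility_eq hY
  obtain ⟨k, hk, hki, hku⟩ := h.utility_eq (hX.add hY)
  have hjump : m * a + n * a ≤ k * a := by
    rcases h.jump_nonneg.eq_or_lt with h0 | ha
    · simp [← h0]
    · have := (hm ha).add_le (hn ha) (hk ha) hX.integrable.aemeasurable hY.integrable.aemeasurable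
      nlinarith
  have hpt : ∀ y, 0 ≤ tailUtility P (c y) (fun ω => X ω + Y ω)
      - (tailUtility P (c y) X + tailUtility P (c y) Y) := fun y =>
    sub_nonneg.2 (tailUtility_add_le hX.integrable hY.integrable (h.level_nonneg y)
      (h.level_le_one y))
  have hdint : IntegrableOn (fun y => tailUtility P (c y) X + tailUtility P (c y) Y) (Ioi 0) :=
    hmi.add hni
  have hdiff : utility P Ψ (fun ω => X ω + Y ω) - (utility P Ψ X + utility P Ψ Y)
      = (k * a - (m * a + n * a)) + ∫ y in Ioi 0, (tailUtility P (c y) (fun ω => X ω + Y ω)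
      - (tailUtility P (c y) X + tailUtility P (c y) Y)) := by
    rw [integral_sub hki hdint, integral_add hmi hni, hmu, hnu, hku]
    ring
  have hnn : 0 ≤ ∫ y in Ioi 0, (tailUtility P (c y) (fun ω => X ω + Y ω)
      - (tailUtility P (c y) X + tailUtility P (c y) Y)) := integral_nonneg hpt
  refine ⟨by linarith, fun hs hXc hYc heq => ?_⟩
  have hz : ∫ y in Ioi 0, (tailUtility P (c y) (fun ω => X ω + Y ω)
      - (tailUtility P (c y) X + tailUtility P (c y) Y)) = 0 := by linarith
  rw [integral_eq_zero_iff_of_nonneg hpt (hki.sub hdint)] at hz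
  -- The heights with level in a given rational interval contain an interval of positive length,
  -- hence one at which the tail utility is additive. Countably many rational pairs then share one
  -- null set.
  have hlevel : ∀ q : ℚ × ℚ, 0 < (q.1 : ℝ) → (q.1 : ℝ) < q.2 → (q.2 : ℝ) < 1 →
      ∀ᵐ ω ∂P, ∃ v s r, v ∈ Icc (q.1 : ℝ) q.2 ∧ IsQuantile P v X s ∧ IsQuantile P v Y r ∧
        (X ω < s → Y ω ≤ r) ∧ (Y ω < r → X ω ≤ s) := by
    intro q h1 h2 h3
    obtain ⟨l, u, hl, hlu, hy⟩ := hdense hs _ _ h1 h2 h3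
    have hsub : Ioo l u ⊆ Ioi 0 := fun y hy => hl.trans_lt hy.1
    have hpos : volume.restrict (Ioi 0) (Ioo l u) ≠ 0 := by
      rw [Measure.restrict_apply measurableSet_Ioo, inter_eq_left.2 hsub]
      simp [hlu]
    have hfreq : ∃ y ∈ Ioo l u, tailUtility P (c y) (fun ω => X ω + Y ω)
        - (tailUtility P (c y) X + tailUtility P (c y) Y) = 0 := by
      by_contra! hcon
      exact hpos (measure_mono_null (fun y hy => hcon y hy) (ae_iff.1 hz))
    obtain ⟨y, hymem, hyz⟩ := hfreq
    have hv := hy y hymem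
    obtain ⟨s, r, hs', hr', hae⟩ := exists_isQuantile_of_tailUtility_add hX.integrable
      hY.integrable (h1.trans_le hv.1) (hv.2.trans_lt h3) (sub_eq_zero.1 hyz).symm
    filter_upwards [hae] with ω hω
    exact ⟨c y, s, r, hv, hs', hr', hω⟩
  have hall : ∀ᵐ ω ∂P, ∀ q : ℚ × ℚ, 0 < (q.1 : ℝ) → (q.1 : ℝ) < q.2 → (q.2 : ℝ) < 1 →
      ∃ v s r, v ∈ Icc (q.1 : ℝ) q.2 ∧ IsQuantile P v X s ∧ IsQuantile P v Y r ∧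
        (X ω < s → Y ω ≤ r) ∧ (Y ω < r → X ω ≤ s) := by
    rw [ae_all_iff]
    intro q
    by_cases hq : 0 < (q.1 : ℝ) ∧ (q.1 : ℝ) < q.2 ∧ (q.2 : ℝ) < 1
    · filter_upwards [hlevel q hq.1 hq.2.1 hq.2.2] with ω hω _ _ _ using hω
    · exact Eventually.of_forall fun ω h1 h2 h3 => absurd ⟨h1, h2, h3⟩ hq
  filter_upwards [hall] with ω hω
  -- Continuity makes the distribution function at a `v`-quantile at most `v`, so "same side of the
  -- quantiles" becomes a comparison of ranks. Unequal ranks would be separated by a rational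
  -- interval.
  have key : ∀ {U V : Ω → ℝ} {v s r : ℝ}, Continuous (fun x => cdf (P.map V) x) →
      IsQuantile P v U s → IsQuantile P v V r → (U ω < s → V ω ≤ r) →
      cdf (P.map U) (U ω) < v → cdf (P.map V) (V ω) ≤ v := by
    intro U V v s r hc hU hV himp h1
    have hUs : U ω < s := not_le.1 fun hle => absurd (hU.2 _ hle) (not_le.2 h1)
    exact (monotone_cdf _ (himp hUs)).trans (hV.apply_le hc)
  have hrat : ∀ x y : ℝ, x < y → ∃ q : ℚ × ℚ, x < q.1 ∧ (q.1 : ℝ) < q.2 ∧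
      (q.2 : ℝ) < y := fun x y hxy => by
    obtain ⟨q₁, h1, h2⟩ := exists_rat_btwn hxy
    obtain ⟨q₂, h3, h4⟩ := exists_rat_btwn h2
    exact ⟨(q₁, q₂), h1, h3, h4⟩
  rcases lt_trichotomy (cdf (P.map X) (X ω)) (cdf (P.map Y) (Y ω)) with hc | hc | hc
  · obtain ⟨q, h1, h2, h3⟩ := hrat _ _ hc
    obtain ⟨v, s, r, hv, hs', hr', hsr, -⟩ := hω q ((cdf_nonneg _ _).trans_lt h1) h2
      (h3.trans_le (cdf_le_one _ _))
    have := key hYc hs' hr' hsr (h1.trans_le hv.1)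
    linarith [hv.2]
  · exact hc
  · obtain ⟨q, h1, h2, h3⟩ := hrat _ _ hc
    obtain ⟨v, s, r, hv, hs', hr', -, hrs⟩ := hω q ((cdf_nonneg _ _).trans_lt h1) h2
      (h3.trans_le (cdf_le_one _ _))
    have := key hXc hr' hs' hrs (h1.trans_le hv.1)
    linarith [hv.2]

end Superadditivity

/-! ### Laws without atoms -/

section Atomless

variable (μ : Measure ℝ) [IsProbabilityMeasure μ] [NullSingletonClass μ]

theorem continuous_cdf : Continuous fun x => cdf μ x := by
  rw [continuous_iff_continuousAt]
  intro x
  rw [(monotone_cdf μ).continuousAt_iff_leftLim_eq_rightLim, (cdf μ).rightLim_eq]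
  refine le_antisymm ((monotone_cdf μ).leftLim_le le_rfl) ?_
  have h := (cdf μ).measure_singleton x
  rw [measure_cdf, measure_singleton] at h
  exact sub_nonpos.1 (ENNReal.ofReal_eq_zero.1 h.symm)

/-- By inner regularity it is enough to treat a compact subset; it lies between its infimum and
supremum, where the distribution function takes the same value. -/
theorem measure_cdf_level (v : ℝ) : μ {x | cdf μ x = v} = 0 := by
  have hcl : IsClosed {x | cdf μ x = v} := isClosed_eq (continuous_cdf μ) continuous_const
  rw [hcl.measurableSet.measure_eq_iSup_isCompact]
  simp only [ENNReal.iSup_eq_zero]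
  intro K hK hKc
  rcases K.eq_empty_or_nonempty with rfl | hne
  · simp
  have h1 := hK (hKc.sInf_mem hne)
  have h2 := hK (hKc.sSup_mem hne)
  simp only [mem_ofPred_eq] at h1 h2
  refine measure_mono_null (subset_Icc_csInf_csSup hKc.bddBelow hKc.bddAbove) ?_
  rw [measure_congr Ioc_ae_eq_Icc.symm, ← measure_cdf μ, StieltjesFunction.measure_Ioc, h1, h2]
  simp

end Atomless

/-! ### Portfolios on different rays are not comonotone -/

section Density

variable {Ω : Type*} [MeasurableSpace Ω] {P : Measure Ω} [IsProbabilityMeasure P] {X Y : Ω → ℝ}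

/-- Two variables with a joint density are not comonotone. -/
theorem not_ae_cdf_eq_of_absolutelyContinuous (hX : AEMeasurable X P) (hY : AEMeasurable Y P)
    [NullSingletonClass (P.map Y)] (hac : P.map (fun ω => (X ω, Y ω)) ≪ volume) :
    ¬ ∀ᵐ ω ∂P, cdf (P.map X) (X ω) = cdf (P.map Y) (Y ω) := by
  intro h
  have := Measure.isProbabilityMeasure_map hY
  -- The set `A` is null for the law of `Y` and contains any two points with equal `D_Y`, as a
  -- rational lies between them. Off `A` the function `D_Y` is injective, so the comonotonicity set
  -- has sections of at most one point and zero area.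
  set A : Set ℝ := ⋃ q : ℚ, {y | cdf (P.map Y) y = cdf (P.map Y) q} with hA
  have hAm : MeasurableSet A := MeasurableSet.iUnion fun q =>
    measurableSet_eq_fun (measurable_cdf _) measurable_const
  have hA0 : P.map Y A = 0 := measure_iUnion_null fun q => measure_cdf_level _ _
  set N : Set (ℝ × ℝ) := {z | cdf (P.map X) z.1 = cdf (P.map Y) z.2} ∩ {z | z.2 ∉ A} with hN
  have hNm : MeasurableSet N := (measurableSet_eq_fun ((measurable_cdf _).comp measurable_fst)
    ((measurable_cdf _).comp measurable_snd)).inter (measurable_snd hAm.compl)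
  have hN0 : volume N = 0 := by
    rw [Measure.volume_eq_prod, Measure.measure_prod_null hNm]
    refine Eventually.of_forall fun x => Set.Subsingleton.measure_zero ?_ _
    have key : ∀ y₁ y₂, (x, y₁) ∈ N → (x, y₂) ∈ N → ¬ y₁ < y₂ := by
      intro y₁ y₂ h1 h2 hlt
      obtain ⟨q, hq1, hq2⟩ := exists_rat_btwn hlt
      have e : cdf (P.map Y) y₁ = cdf (P.map Y) y₂ := h1.1.symm.trans h2.1
      refine h1.2 (mem_iUnion.2 ⟨q, le_antisymm (monotone_cdf _ hq1.le) ?_⟩)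
      rw [e]
      exact monotone_cdf _ hq2.le
    intro y₁ h1 y₂ h2
    exact le_antisymm (not_lt.1 (key _ _ h2 h1)) (not_lt.1 (key _ _ h1 h2))
  have h1 : ∀ᵐ ω ∂P, (X ω, Y ω) ∉ N :=
    ae_of_ae_map (hX.prodMk hY) (measure_eq_zero_iff_ae_notMem.1 (hac hN0))
  have h2 : ∀ᵐ ω ∂P, Y ω ∉ A := ae_of_ae_map hY (measure_eq_zero_iff_ae_notMem.1 hA0)
  have h3 : ∀ᵐ _ω ∂P, False := by
    filter_upwards [h, h1, h2] with ω e1 e2 e3 using e2 ⟨e1, e3⟩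
  rw [ae_iff] at h3
  simp at h3

/-- A continuously distributed variable is not comonotone with its negative multiples. -/
theorem not_ae_cdf_eq_of_neg_mul (hX : AEMeasurable X P) [NullSingletonClass (P.map X)] {c : ℝ} (hc : c < 0) :
    ¬ ∀ᵐ ω ∂P, cdf (P.map X) (X ω) = cdf (P.map fun ω => c * X ω) (c * X ω) := by
  intro h
  have := Measure.isProbabilityMeasure_map hX
  -- A negative multiple reverses ranks, so comonotonicity would force `D_X(X) = 1/2` almost surely,
  -- a null event.
  have key : ∀ x, cdf (P.map fun ω => c * X ω) (c * x) = 1 - cdf (P.map X) x := by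
    intro x
    rw [cdf_map_apply (hX.const_mul c), cdf_eq_real, ← probReal_compl_eq_one_sub measurableSet_Iic,
      compl_Iic, measureReal_congr Ioi_ae_eq_Ici,
      map_measureReal_apply_of_aemeasurable hX measurableSet_Ici]
    congr 1
    ext ω
    exact mul_le_mul_left_of_neg hc
  have h1 : ∀ᵐ ω ∂P, X ω ∉ {x | cdf (P.map X) x = 1 / 2} :=
    ae_of_ae_map hX (measure_eq_zero_iff_ae_notMem.1 (measure_cdf_level _ _))
  have h3 : ∀ᵐ _ω ∂P, False := by
    filter_upwards [h, h1] with ω e1 e2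
    rw [key] at e1
    exact e2 (show cdf (P.map X) (X ω) = 1 / 2 by linarith)
  rw [ae_iff] at h3
  simp at h3

variable {d : ℕ} {S₀ : Fin d → ℝ} {S₁ : Ω → Fin d → ℝ}

omit [IsProbabilityMeasure P] in
theorem map_sub_absolutelyContinuous {F : Type*} [NormedAddCommGroup F] [NormedSpace ℝ F]
    [FiniteDimensional ℝ F] [MeasureSpace F] [BorelSpace F]
    [(volume : Measure F).IsAddHaarMeasure] (hS : AEMeasurable S₁ P)
    (hac : P.map S₁ ≪ volume) (L : (Fin d → ℝ) →ₗ[ℝ] F) (hL : Function.Surjective L) (b : F) :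
    P.map (fun ω => L (S₁ ω) - b) ≪ volume := by
  have hLm : Measurable L := L.continuous_of_finiteDimensional.measurable
  refine Measure.AbsolutelyContinuous.mk fun s hs h0 => ?_
  have hsub : Measurable fun y : F => y - b := measurable_sub_const b
  have h1 : ∀ᵐ y : F, y ∈ ((fun y => y - b) ⁻¹' s)ᶜ := by
    refine measure_eq_zero_iff_ae_notMem.1 ?_
    simp only [sub_eq_add_neg, measure_preimage_add_right, h0]
  have h2 := (ae_comp_linearMap_mem_iff L volume volume hL (hsub hs).compl).2 h1
  have h3 := ae_of_ae_map hS (hac.ae_le h2)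
  have hm : AEMeasurable (fun ω => L (S₁ ω) - b) P := (hLm.comp_aemeasurable hS).sub_const b
  rw [Measure.map_apply_of_aemeasurable hm hs]
  exact measure_eq_zero_iff_ae_notMem.2 h3

/-- The linear functional `v ↦ ⟨h, v⟩`. -/
def pairing (h : Fin d → ℝ) : (Fin d → ℝ) →ₗ[ℝ] ℝ := ∑ i, h i • LinearMap.proj i

theorem pairing_apply (h v : Fin d → ℝ) : pairing h v = h ⬝ᵥ v := by
  simp [pairing, dotProduct]

omit [MeasurableSpace Ω] in
theorem pnl_eq_pairing (h : Fin d → ℝ) (ω : Ω) :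
    pnl S₀ S₁ h ω = pairing h (S₁ ω) - pairing h S₀ := by
  simp [pairing_apply, pnl, dotProduct, mul_sub, Finset.sum_sub_distrib]

omit [MeasurableSpace Ω] in
theorem pnl_smul (c : ℝ) (h : Fin d → ℝ) : pnl S₀ S₁ (c • h) = fun ω => c * pnl S₀ S₁ h ω := by
  ext ω
  simp [pnl, Finset.mul_sum, mul_assoc]

omit [MeasurableSpace Ω] in
theorem pnl_add (h k : Fin d → ℝ) :
    pnl S₀ S₁ (h + k) = fun ω => pnl S₀ S₁ h ω + pnl S₀ S₁ k ω := by
  ext ω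
  simp [pnl, add_mul, Finset.sum_add_distrib]

theorem pairing_surjective {h : Fin d → ℝ} (hh : h ≠ 0) : Function.Surjective (pairing h) := by
  have h0 : h ⬝ᵥ h ≠ 0 := fun e => hh (dotProduct_self_eq_zero.1 e)
  intro x
  refine ⟨(x / (h ⬝ᵥ h)) • h, ?_⟩
  rw [pairing_apply, dotProduct_smul, smul_eq_mul, div_mul_cancel₀ _ h0]

theorem pairing_prod_surjective {h k : Fin d → ℝ} (hh : h ≠ 0) (hk : ∀ c : ℝ, k ≠ c • h) :
    Function.Surjective ((pairing h).prod (pairing k)) := by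
  have h0 : h ⬝ᵥ h ≠ 0 := fun e => hh (dotProduct_self_eq_zero.1 e)
  -- Gram–Schmidt: `w` is the nonzero part of `k` orthogonal to `h`, so the two equations become
  -- triangular.
  set w := k - ((h ⬝ᵥ k) / (h ⬝ᵥ h)) • h with hw
  have hw0 : w ⬝ᵥ w ≠ 0 := fun e => hk _ (sub_eq_zero.1 (dotProduct_self_eq_zero.1 e))
  have hhw : h ⬝ᵥ w = 0 := by
    rw [hw, dotProduct_sub, dotProduct_smul, smul_eq_mul, div_mul_cancel₀ _ h0, sub_self]
  have hkw : k ⬝ᵥ w = w ⬝ᵥ w := by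
    conv_rhs => rw [hw, sub_dotProduct, ← hw, smul_dotProduct, hhw, smul_zero, sub_zero]
  rintro ⟨x, y⟩
  refine ⟨(x / (h ⬝ᵥ h)) • h + ((y - x / (h ⬝ᵥ h) * (k ⬝ᵥ h)) / (w ⬝ᵥ w)) • w, ?_⟩
  simp only [LinearMap.prod_apply, Function.prod_apply, pairing_apply, dotProduct_add,
    dotProduct_smul, smul_eq_mul, hhw, hkw, Prod.mk.injEq]
  constructor
  · field_simp
    ring
  · field_simp
    ring

omit [IsProbabilityMeasure P] in
theorem aemeasurable_pnl (hS : AEMeasurable S₁ P) (h : Fin d → ℝ) :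
    AEMeasurable (pnl S₀ S₁ h) P := by
  have hLm : Measurable (pairing h) := (pairing h).continuous_of_finiteDimensional.measurable
  have := (hLm.comp_aemeasurable hS).sub_const (pairing h S₀)
  exact this.congr (Eventually.of_forall fun ω => (pnl_eq_pairing h ω).symm)

omit [IsProbabilityMeasure P] in
theorem nullSingletonClass_map_pnl (hS : AEMeasurable S₁ P) (hac : P.map S₁ ≪ volume) {h : Fin d → ℝ}
    (hh : h ≠ 0) : NullSingletonClass (P.map (pnl S₀ S₁ h)) := by
  refine ⟨fun x => ?_⟩
  have := map_sub_absolutelyContinuous hS hac (pairing h) (pairing_surjective hh) (pairing h S₀)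
  simp only [← pnl_eq_pairing (S₀ := S₀) h] at this
  exact this (measure_singleton x)

/-- Portfolios that are not positive multiples of each other are not comonotone. -/
theorem not_ae_cdf_pnl_eq (hS : AEMeasurable S₁ P) (hac : P.map S₁ ≪ volume) {h k : Fin d → ℝ}
    (hh : h ≠ 0) (hk : k ≠ 0) (hhk : ∀ c : ℝ, 0 < c → k ≠ c • h) :
    ¬ ∀ᵐ ω ∂P, cdf (P.map (pnl S₀ S₁ h)) (pnl S₀ S₁ h ω)
      = cdf (P.map (pnl S₀ S₁ k)) (pnl S₀ S₁ k ω) := by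
  have := nullSingletonClass_map_pnl (S₀ := S₀) hS hac hh
  have := nullSingletonClass_map_pnl (S₀ := S₀) hS hac hk
  by_cases hprop : ∃ c : ℝ, k = c • h
  · obtain ⟨c, rfl⟩ := hprop
    have hc : c < 0 := by
      rcases lt_trichotomy c 0 with hc | rfl | hc
      · exact hc
      · simp at hk
      · exact absurd rfl (hhk c hc)
    rw [pnl_smul]
    exact not_ae_cdf_eq_of_neg_mul (aemeasurable_pnl hS h) hc
  · push Not at hprop
    refine not_ae_cdf_eq_of_absolutelyContinuous (aemeasurable_pnl hS h) (aemeasurable_pnl hS k) ?_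
    have := map_sub_absolutelyContinuous hS hac _ (pairing_prod_surjective hh hprop)
      (pairing h S₀, pairing k S₀)
    simpa only [LinearMap.prod_apply, Function.prod_apply, Prod.mk_sub_mk,
      ← pnl_eq_pairing (S₀ := S₀)] using this

end Density

/-! ### Maximizing the index of a decreasing family of superlinear functionals -/

section Optimization

variable {E : Type*} {V : ℝ≥0 → E → ℝ}

/-- The largest parameter `t` at which `V t x` is nonnegative. -/
def levelIndex (V : ℝ≥0 → E → ℝ) (x : E) : ℝ≥0∞ := ⨆ (t : ℝ≥0) (_ : 0 ≤ V t x), (t : ℝ≥0∞)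

theorem le_levelIndex {t : ℝ≥0} {x : E} (h : 0 ≤ V t x) : (t : ℝ≥0∞) ≤ levelIndex V x :=
  le_iSup₂_of_le t h le_rfl

theorem nonneg_of_lt_levelIndex (hanti : ∀ x, Antitone fun t => V t x) {t : ℝ≥0} {x : E}
    (h : (t : ℝ≥0∞) < levelIndex V x) : 0 ≤ V t x := by
  simp only [levelIndex, lt_iSup_iff] at h
  obtain ⟨s, hs, hts⟩ := h
  exact hs.trans (hanti x (by exact_mod_cast hts.le))

variable [NormedAddCommGroup E] [NormedSpace ℝ E]

theorem levelIndex_smul (hhom : ∀ t x, ∀ c : ℝ, 0 < c → V t (c • x) = c * V t x) (x : E) {c : ℝ}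
    (hc : 0 < c) : levelIndex V (c • x) = levelIndex V x := by
  simp only [levelIndex, hhom _ _ _ hc, mul_nonneg_iff_of_pos_left hc]

variable [FiniteDimensional ℝ E]

/-- Maximization of the index of a decreasing family of superlinear functionals that are strictly
superadditive off common rays. -/
theorem exists_unique_ray_levelIndex
    (hsup : ∀ t x y, V t x + V t y ≤ V t (x + y))
    (hhom : ∀ t x, ∀ c : ℝ, 0 < c → V t (c • x) = c * V t x)
    (hanti : ∀ x, Antitone fun t => V t x)
    (hright : ∀ t x, Tendsto (fun n : ℕ => V (t + 1 / ((n : ℝ≥0) + 1)) x) atTop (𝓝 (V t x)))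
    (hleft : ∀ t x, 0 < t →
      Tendsto (fun n : ℕ => V (t - 1 / ((n : ℝ≥0) + 1)) x) atTop (𝓝 (V t x)))
    (hneg : ∀ x, x ≠ 0 → ∃ t, V t x < 0) (hpos : ∃ x, 0 < V 0 x)
    (hstrict : ∀ t x y, 0 < t → x ≠ 0 → y ≠ 0 → (∀ c : ℝ, 0 < c → y ≠ c • x) →
      V t x + V t y ≠ V t (x + y)) :
    0 < (⨆ (x : E) (_ : x ≠ 0), levelIndex V x) ∧ (⨆ (x : E) (_ : x ≠ 0), levelIndex V x) < ⊤ ∧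
    ∃ x₀ : E, (x₀ ≠ 0 ∧ ∀ y, y ≠ 0 → levelIndex V y ≤ levelIndex V x₀) ∧
      ∀ x, (x ≠ 0 ∧ ∀ y, y ≠ 0 → levelIndex V y ≤ levelIndex V x) ↔
        ∃ c : ℝ, 0 < c ∧ x = c • x₀ := by
  have hzero : ∀ t, V t 0 = 0 := fun t => by
    have := hhom t 0 2 two_pos
    rw [smul_zero] at this
    linarith
  have hcont : ∀ t, Continuous (V t) := fun t => by
    have hconc : ConcaveOn ℝ univ (V t) := by
      refine ⟨convex_univ, fun x _ y _ a b ha hb hab => ?_⟩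
      rcases ha.eq_or_lt with rfl | ha
      · simp [(by simpa using hab : b = 1)]
      rcases hb.eq_or_lt with rfl | hb
      · simp [(by simpa using hab : a = 1)]
      have := hsup t (a • x) (b • y)
      rwa [hhom t x a ha, hhom t y b hb] at this
    exact continuousOn_univ.1 (hconc.continuousOn isOpen_univ)
  set σ := ⨆ (x : E) (_ : x ≠ 0), levelIndex V x with hσ
  have hleσ : ∀ x : E, x ≠ 0 → levelIndex V x ≤ σ := fun x hx => le_iSup₂_of_le x hx le_rfl
  set K : ℝ≥0 → Set E := fun t => Metric.sphere 0 1 ∩ {x | 0 ≤ V t x} with hK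
  have hKclosed : ∀ t, IsClosed (K t) := fun t =>
    Metric.isClosed_sphere.inter (isClosed_le continuous_const (hcont t))
  have hKcompact : ∀ t, IsCompact (K t) := fun t =>
    (isCompact_sphere 0 1).inter_right (isClosed_le continuous_const (hcont t))
  have hKanti : Antitone K := fun s t hst x hx => ⟨hx.1, hx.2.trans (hanti x hst)⟩
  have hKne : ∀ t x, x ≠ 0 → 0 ≤ V t x → (K t).Nonempty := fun t x hx h => by
    have hn : 0 < ‖x‖⁻¹ := inv_pos.2 (norm_pos_iff.2 hx)
    refine ⟨‖x‖⁻¹ • x, ?_, ?_⟩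
    · simp [norm_smul, hx]
    · simp only [mem_ofPred_eq, hhom t x _ hn]
      exact mul_nonneg hn.le h
  have hne0 : ∀ t x, x ∈ K t → x ≠ 0 := fun t x hx h0 => by
    have := hx.1
    simp [h0] at this
  -- By right-continuity, strict positivity at `t` survives to a later time. This yields both
  -- positivity of the optimum and uniqueness.
  have hgain : ∀ t x, 0 < V t x → ∃ s, t < s ∧ (s : ℝ≥0∞) ≤ levelIndex V x := fun t x h => by
    obtain ⟨n, hn⟩ := ((hright t x).eventually (lt_mem_nhds h)).exists
    exact ⟨_, lt_add_of_pos_right t (by positivity), le_levelIndex hn.le⟩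
  have hσpos : 0 < σ := by
    obtain ⟨x, hx⟩ := hpos
    obtain ⟨s, hs, hsx⟩ := hgain 0 x hx
    have hx0 : x ≠ 0 := fun h => by simp [h, hzero] at hx
    exact lt_of_lt_of_le (by exact_mod_cast hs) (hsx.trans (hleσ x hx0))
  have hσtop : σ < ⊤ := by
    -- Otherwise the nested compact sets `K t` share a unit vector that is acceptable at all times,
    -- against `hneg`.
    obtain ⟨T, hT⟩ : ∃ T, ¬ (K T).Nonempty := by
      by_contra! hall
      obtain ⟨x, hx⟩ := IsCompact.nonempty_iInter_of_directed_nonempty_isCompact_isClosed K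
        hKanti.directed_ge hall hKcompact hKclosed
      rw [mem_iInter] at hx
      obtain ⟨t, ht⟩ := hneg x (hne0 0 x (hx 0))
      exact absurd (hx t).2 (not_le.2 ht)
    refine lt_of_le_of_lt (iSup₂_le fun x hx => ?_) (ENNReal.coe_lt_top (r := T))
    by_contra! hlt
    exact hT (hKne T x hx (nonneg_of_lt_levelIndex hanti hlt))
  lift σ to ℝ≥0 using hσtop.ne with τ
  have hτ : 0 < τ := by exact_mod_cast hσpos
  -- Left-continuity is what makes the supremum in the index attained at time `τ`.
  have hopt : ∀ x, (τ : ℝ≥0∞) ≤ levelIndex V x → 0 ≤ V τ x := fun x hx => by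
    refine ge_of_tendsto (hleft τ x hτ) (Eventually.of_forall fun n => ?_)
    refine nonneg_of_lt_levelIndex hanti (lt_of_lt_of_le ?_ hx)
    exact_mod_cast tsub_lt_self hτ (by positivity)
  obtain ⟨x₀, hx₀ne, hx₀⟩ : ∃ x₀ : E, x₀ ≠ 0 ∧ (τ : ℝ≥0∞) ≤ levelIndex V x₀ := by
    have hne : Nonempty {t : ℝ≥0 // t < τ} := ⟨⟨0, hτ⟩⟩
    obtain ⟨x, hx⟩ := IsCompact.nonempty_iInter_of_directed_nonempty_isCompact_isClosed
      (fun t : {t : ℝ≥0 // t < τ} => K t)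
      (Antitone.directed_ge fun s t hst => hKanti hst)
      (fun t => by
        have ht : ((t : ℝ≥0) : ℝ≥0∞) < ⨆ (x : E) (_ : x ≠ 0), levelIndex V x := by
          rw [← hσ]
          exact_mod_cast t.2
        simp only [lt_iSup_iff] at ht
        obtain ⟨x, hx, hlt⟩ := ht
        exact hKne _ x hx (nonneg_of_lt_levelIndex hanti hlt))
      (fun t => hKcompact _) (fun t => hKclosed _)
    rw [mem_iInter] at hx
    refine ⟨x, hne0 _ x (hx ⟨0, hτ⟩), le_of_forall_lt fun a ha => ?_⟩
    obtain ⟨b, hab, hbτ⟩ := ENNReal.lt_iff_exists_nnreal_btwn.1 ha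
    exact hab.trans_le (le_levelIndex (hx ⟨b, by exact_mod_cast hbτ⟩).2)
  have hmax₀ : ∀ y, y ≠ 0 → levelIndex V y ≤ levelIndex V x₀ := fun y hy => (hleσ y hy).trans hx₀
  refine ⟨hσpos, ENNReal.coe_lt_top, x₀, ⟨hx₀ne, hmax₀⟩, fun x => ⟨?_, ?_⟩⟩
  · rintro ⟨hx, hmax⟩
    by_contra! hcon
    have h1 := hopt x₀ hx₀
    have h2 := hopt x (hx₀.trans (hmax x₀ hx₀ne))
    have h3 : 0 < V τ (x₀ + x) := by
      have hle := lt_of_le_of_ne (hsup τ x₀ x) (hstrict τ x₀ x hτ hx₀ne hx hcon)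
      linarith
    have h4 : x₀ + x ≠ 0 := fun h => by simp [h, hzero] at h3
    obtain ⟨s, hs, hle⟩ := hgain τ _ h3
    have : (s : ℝ≥0∞) ≤ τ := hle.trans (hleσ _ h4)
    exact absurd (by exact_mod_cast this) (not_le.2 hs)
  · rintro ⟨c, hc, rfl⟩
    refine ⟨smul_ne_zero hc.ne' hx₀ne, fun y hy => ?_⟩
    rw [levelIndex_smul hhom x₀ hc]
    exact hmax₀ y hy

end Optimization

/-! ### Application to portfolios -/

section Portfolio

variable {Ω : Type*} [MeasurableSpace Ω] {P : Measure Ω}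

theorem index_eq_levelIndex {E : Type*} {Ψ : ℝ≥0 → ConcaveDistortion} {Z : E → Ω → ℝ}
    [IsProbabilityMeasure P] (hZ : ∀ t x, Admissible P (Ψ t) (Z x)) (x : E) :
    index P Ψ (Z x) = levelIndex (fun t x => utility P (Ψ t) (Z x)) x := by
  simp only [index, levelIndex, (hZ _ _).distortedExp_eq_utility, EReal.coe_nonneg]

theorem utility_congr {Φ Ψ : ConcaveDistortion} (h : ∀ p ∈ Icc (0 : ℝ) 1, Φ p = Ψ p) (X : Ω → ℝ) :
    utility P Φ X = utility P Ψ X := by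
  simp only [utility, utilityDensity, distortedCDF, h _ (cdf_mem_Icc _ _)]

variable [IsProbabilityMeasure P] {d : ℕ} {S₀ : Fin d → ℝ} {S₁ : Ω → Fin d → ℝ}

omit [IsProbabilityMeasure P] in
-- A portfolio that never loses must gain with positive probability, since its law has no atom at
-- zero; it would be an arbitrage.
theorem NoArbitrage.measure_pnl_neg_ne_zero (hNA : NoArbitrage P S₀ S₁) (hP : P ≠ 0)
    (hS : AEMeasurable S₁ P) {h : Fin d → ℝ}
    [NullSingletonClass (P.map (pnl S₀ S₁ h))] : P {ω | pnl S₀ S₁ h ω < 0} ≠ 0 := by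
  intro h0
  refine hNA ⟨h, ?_, ?_⟩
  · filter_upwards [measure_eq_zero_iff_ae_notMem.1 h0] with ω hω using not_lt.1 hω
  · rw [pos_iff_ne_zero]
    intro h1
    have h2 : ∀ᵐ ω ∂P, pnl S₀ S₁ h ω ∉ ({0} : Set ℝ) :=
      ae_of_ae_map (aemeasurable_pnl hS h) (measure_eq_zero_iff_ae_notMem.1 (measure_singleton 0))
    have h3 : ∀ᵐ _ω ∂P, False := by
      filter_upwards [measure_eq_zero_iff_ae_notMem.1 h0, measure_eq_zero_iff_ae_notMem.1 h1, h2]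
        with ω e0 e1 e2
      exact e2 (le_antisymm (not_lt.1 e1) (not_lt.1 e0))
    rw [ae_iff] at h3
    simp only [not_false_eq_true] at h3
    exact hP (Measure.measure_univ_eq_zero.1 (by simpa using h3))

theorem integral_pnl (hS : ∀ i, Integrable (fun ω => S₁ ω i) P) (h : Fin d → ℝ) :
    ∫ ω, pnl S₀ S₁ h ω ∂P = ∑ i, h i * (∫ ω, S₁ ω i ∂P - S₀ i) := by
  simp only [pnl]
  have hi : ∀ i, Integrable (fun ω => h i * (S₁ ω i - S₀ i)) P := fun i =>
    ((hS i).sub (integrable_const _)).const_mul _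
  rw [integral_finsetSum _ fun i _ => hi i]
  refine Finset.sum_congr rfl fun i _ => ?_
  rw [integral_const_mul, integral_sub (hS i) (integrable_const _)]
  simp

end Portfolio

end DistortionSemigroup

end

open DistortionSemigroup in
theorem corollary1 {Ω : Type*} [MeasurableSpace Ω] (P : MeasureTheory.Measure Ω)
    [MeasureTheory.IsProbabilityMeasure P]
    (Ψ : ℝ≥0 → DistortionSemigroup.ConcaveDistortion)
    (hΨ : DistortionSemigroup.IsSemigroup Ψ)
    (hstrict : ∀ t : ℝ≥0, 0 < t → StrictConcaveOn ℝ (Set.Icc 0 1) (Ψ t))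
    (d : ℕ) (hd : 1 < d) (S₀ : Fin d → ℝ) (S₁ : Ω → Fin d → ℝ)
    (hS₁ : ∀ i, DistortionSemigroup.MemL1 P Ψ (fun ω => S₁ ω i))
    (hmean : (fun i => ∫ ω, S₁ ω i ∂P) ≠ S₀)
    (hNA : DistortionSemigroup.NoArbitrage P S₀ S₁)
    (hdens : MeasureTheory.HasPDF S₁ P MeasureTheory.volume) :
    0 < DistortionSemigroup.optimalValue P Ψ S₀ S₁ ∧
    DistortionSemigroup.optimalValue P Ψ S₀ S₁ < ⊤ ∧
    ∃ h₀ : Fin d → ℝ, DistortionSemigroup.IsOptimal P Ψ S₀ S₁ h₀ ∧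
      ∀ h : Fin d → ℝ, DistortionSemigroup.IsOptimal P Ψ S₀ S₁ h ↔ ∃ c : ℝ, 0 < c ∧ h = c • h₀ := by
  have hSm : AEMeasurable S₁ P := hdens.aemeasurable'
  have hac : P.map S₁ ≪ volume := hdens.absolutelyContinuous'
  have hadm₁ : ∀ t i, Admissible P (Ψ t) fun ω => S₁ ω i := fun t i =>
    admissible_of_distortedExp (hS₁ i).1 ((hS₁ i).2 t).1 ((hS₁ i).2 t).2
  have hadm₂ : ∀ t i, Admissible P (Ψ t) fun ω => -S₁ ω i := fun t i =>
    admissible_of_distortedExp (hS₁ i).1.neg ((hS₁ i).2 t).2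
      (by simpa using ((hS₁ i).2 t).1)
  have hadm : ∀ t h, Admissible P (Ψ t) (pnl S₀ S₁ h) := fun t h =>
    admissible_pnl (hadm₁ t) (hadm₂ t) h
  have key := exists_unique_ray_levelIndex (E := Fin d → ℝ)
    (V := fun t h => utility P (Ψ t) (pnl S₀ S₁ h)) ?_ ?_ ?_ ?_ ?_ ?_ ?_ ?_
  · simpa only [IsOptimal, optimalValue, index_eq_levelIndex hadm] using key
  · intro t h k
    rw [pnl_add]
    exact (utility_superadditive (hadm t h) (hadm t k)).1
  · intro t h c hc
    rw [pnl_smul]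
    exact utility_const_mul hc (aemeasurable_pnl hSm h)
  · exact fun h => hΨ.utility_anti fun t => hadm t h
  · intro t h
    refine hΨ.tendsto_utility (fun t => hadm t h) (T := t + 1) (fun n => ?_)
      fun p hp => hΨ.tendsto_add_one_div hstrict t hp
    gcongr
    exact div_le_one_of_le₀ (by simp) (by positivity)
  · intro t h ht
    exact hΨ.tendsto_utility (fun t => hadm t h) (T := t) (fun n => tsub_le_self)
      fun p hp => hΨ.tendsto_sub_one_div hstrict t ht hp
  · intro h hh
    have := nullSingletonClass_map_pnl (S₀ := S₀) hSm hac hh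
    exact hΨ.exists_utility_neg hstrict (fun t => hadm t h)
      (hNA.measure_pnl_neg_ne_zero (IsProbabilityMeasure.ne_zero P) hSm)
  -- The portfolio `E S₁ - S₀` has expected gain equal to its squared Euclidean length, positive by
  -- `hmean`.
  · refine ⟨fun i => ∫ ω, S₁ ω i ∂P - S₀ i, ?_⟩
    rw [utility_congr (Ψ := idDistortion) (fun p hp => hΨ.apply_zero hstrict hp),
      utility_id (hadm 0 _).integrable, integral_pnl fun i => (hadm₁ 0 i).integrable]
    obtain ⟨i, hi⟩ := Function.ne_iff.1 hmean
    exact Finset.sum_pos' (fun i _ => mul_self_nonneg _)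
      ⟨i, Finset.mem_univ i, mul_self_pos.2 (sub_ne_zero.2 hi)⟩
  · intro t h k ht hh hk hhk heq
    have := nullSingletonClass_map_pnl (S₀ := S₀) hSm hac hh
    have := nullSingletonClass_map_pnl (S₀ := S₀) hSm hac hk
    have := Measure.isProbabilityMeasure_map (aemeasurable_pnl (S₀ := S₀) hSm h)
    have := Measure.isProbabilityMeasure_map (aemeasurable_pnl (S₀ := S₀) hSm k)
    refine not_ae_cdf_pnl_eq (S₀ := S₀) hSm hac hh hk hhk ?_
    rw [pnl_add] at heq
    exact (utility_superadditive (hadm t h) (hadm t k)).2 (hstrict t ht)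
      (continuous_cdf _) (continuous_cdf _) heq
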